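/- Let $\{a<b\}$ be a binary alphabet, let $\Gamma$ be a finite totally ordered alphabet, and let $\mu:\{a,b\}^*\to\Gamma^*$ be an injective morphism (i.e. $\mu(uv)=\mu(u)\mu(v)$ for all words $u,v$). For a word $w$ over a totally ordered alphabet, let $\mathsf{bwt}(w)$ be its Burrows–Wheeler transform, i.e. the word obtained by sorting the $|w|$ rotations of $w$ (with multiplicity) in ascending lexicographic order and concatenating the last letter of each of them, and let $r(w)$ be the number of maximal equal-letter runs of $\mathsf{bwt}(w)$. The additive sensitivity function of $\mu$ is $$AS_\mu(n)=\max_{w\in\{a,b\}^n}\bigl(r(\mu(w))-r(w)\bigr).$$ An acyclic morphism $\mu$ (one for which there is no non-empty word $z$ such that $\mu(a)$ and $\mu(b)$ both lie in $z^*$) is called *BWT-run preserving* if there is an integer $k\ge 0$ such that $AS_\mu(n)\le k$ for all $n\ge 2$. A non-empty word $w$ is *primitive* if $w=u^k$ with $u$ a non-empty word implies $k=1$, and $\mu$ is *primitivity-preserving* if $\mu(w)$ is primitive for every primitive word $w\in\{a,b\}^*$. Then $\mu$ is BWT-run preserving if and only if it is primitivity-preserving. -/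

import Mathlib

/-! Words over an alphabet `α` are the elements of the free monoid `FreeMonoid α`, the empty word is
`1`, and a morphism `μ : Σ* → Γ*` is a monoid homomorphism `FreeMonoid σ →* FreeMonoid Γ`. -/

namespace BWT

/-- A word is primitive if it is non-empty and `w = u ^ k` with `u` non-empty forces `k = 1`. -/
def IsPrimitive {α : Type*} (w : FreeMonoid α) : Prop :=
  w ≠ 1 ∧ ∀ u : FreeMonoid α, u ≠ 1 → ∀ k : ℕ, w = u ^ k → k = 1

/-- A morphism is primitivity-preserving if it maps primitive words to primitive words. -/
def PrimitivityPreserving {σ Γ : Type*} (μ : FreeMonoid σ →* FreeMonoid Γ) : Prop :=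
  ∀ w : FreeMonoid σ, IsPrimitive w → IsPrimitive (μ w)

/-- A morphism is cyclic if the images of all letters are powers of one non-empty word `z`. -/
def IsCyclicMorphism {σ Γ : Type*} (μ : FreeMonoid σ →* FreeMonoid Γ) : Prop :=
  ∃ z : FreeMonoid Γ, z ≠ 1 ∧ ∀ c : σ, ∃ k : ℕ, μ (FreeMonoid.of c) = z ^ k

/-- The multiset of the `|w|` rotations of `w`. -/
def rotations {α : Type*} (w : FreeMonoid α) : Multiset (List α) :=
  (Multiset.range w.toList.length).map fun i => w.toList.rotate i

/-- The Burrows–Wheeler transform: sort all rotations of `w` in ascending lexicographic order (the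
order of `List α`) and concatenate the last letter of each rotation. -/
def bwt {α : Type*} [LinearOrder α] (w : FreeMonoid α) : FreeMonoid α :=
  FreeMonoid.ofList (((rotations w).sort (· ≤ ·)).filterMap List.getLast?)

/-- The run-length encoding: the list of pairs `(c, l)` of the maximal equal-letter runs. -/
def rle {α : Type*} [DecidableEq α] : List α → List (α × ℕ)
  | [] => []
  | c :: t =>
    match rle t with
    | [] => [(c, 1)]
    | (d, l) :: s => if c = d then (d, l + 1) :: s else (c, 1) :: (d, l) :: s

/-- `r w`, the number of equal-letter runs of the Burrows–Wheeler transform of `w`. -/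
def r {α : Type*} [LinearOrder α] (w : FreeMonoid α) : ℕ :=
  (rle (bwt w).toList).length

/-- `Δ⁺_μ(w) = r(μ(w)) - r(w)`, an integer. -/
def addIncrease {σ Γ : Type*} [LinearOrder σ] [LinearOrder Γ]
    (μ : FreeMonoid σ →* FreeMonoid Γ) (w : FreeMonoid σ) : ℤ :=
  (r (μ w) : ℤ) - (r w : ℤ)

/-- The additive sensitivity function `AS_μ(n)`: the maximum of `Δ⁺_μ(w)` over all words `w` of
length `n`. -/
def additiveSensitivity {σ Γ : Type*} [Fintype σ] [Nonempty σ] [LinearOrder σ] [LinearOrder Γ]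
    (μ : FreeMonoid σ →* FreeMonoid Γ) (n : ℕ) : ℤ :=
  (Finset.univ : Finset (Fin n → σ)).sup' Finset.univ_nonempty
    fun w => addIncrease μ (FreeMonoid.ofList (List.ofFn w))

/-- `μ` is `k`-BWT-run preserving: it is acyclic and `AS_μ(n) ≤ k` for all `n ≥ |Σ|`. -/
def IsBWTRunPreservingWith {σ Γ : Type*} [Fintype σ] [Nonempty σ] [LinearOrder σ] [LinearOrder Γ]
    (k : ℕ) (μ : FreeMonoid σ →* FreeMonoid Γ) : Prop :=
  ¬ IsCyclicMorphism μ ∧ ∀ n : ℕ, Fintype.card σ ≤ n → additiveSensitivity μ n ≤ (k : ℤ)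

/-- `μ` is BWT-run preserving if it is `k`-BWT-run preserving for some `k`. -/
def IsBWTRunPreserving {σ Γ : Type*} [Fintype σ] [Nonempty σ] [LinearOrder σ] [LinearOrder Γ]
    (μ : FreeMonoid σ →* FreeMonoid Γ) : Prop :=
  ∃ k : ℕ, IsBWTRunPreservingWith k μ

end BWT

/-!
A binary morphism is injective exactly when the images of the two letters do not commute
(`Noncomm`), so both conditions concern such morphisms. Up to conjugacy, which changes neither the
rotations nor primitivity, the two images may be assumed to end with different letters
(`LastDiffer`). The number of runs of the Burrows–Wheeler transform is one more than the number of
transitions, i.e. of pairs of adjacent rotations that end with different letters (`r_eq`).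

*Primitivity-preserving morphisms add boundedly many runs* (`Noncomm.exists_r_le`). Transitions of
the image between rotations that start at the beginning of images of letters come from transitions
of `w`, because a binary morphism either preserves or reverses the order of rotations
(`IsSplit.map_lt_map`). Among the other transitions, those whose rotations differ within the first
`L` letters are separated by one of the finitely many words of length at most `L`
(`card_le_card_of_separated`). If the two rotations agree for `L` letters but are cut differently
into images of letters, then by the pigeonhole principle the same overhang `e` between the two
factorizations occurs twice, which yields an equation `μ(x) e = e μ(y)`
(`LastDiffer.sync_or_overhang`). Since `μ` preserves primitivity, the primitive roots of `x` and `y`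
have conjugate images. They are not conjugate themselves, as the factorizations are shifted, and
then they are the two letters (`LastDiffer.letters_of_conj`): otherwise the periodic repetition of
the image, which has fewer branching factors than the length of its period, would have to contain
too many of them. So both rotations follow for a while one and the same periodic word, they leave it
in opposite directions, and they are separated by one of finitely many periodic words
(`not_above_and_above`).

*If `μ(w)` is a proper power `u ^ k` for a primitive word `w`, then the number of added runs is
unbounded.* There is a primitivity-preserving morphism `φ` with `φ(a) = w`
(`exists_primitivityPreserving`), and `μ ∘ φ` is the composition of the morphism `a ↦ a ^ k`,
`b ↦ b` with the morphism `a ↦ u`, `b ↦ μ(φ(b))`. The latter does not decrease the number of runs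
(`Noncomm.r_le_r_map`), the former adds at least `m` runs to the word `V = nestedWord m`
(`r_nestedWord_add_le`), and `r(φ(V))` exceeds `r(V)` by a bounded amount. Hence
`r(μ(φ(V))) - r(φ(V))` is at least `m` up to a constant, for every `m`.
-/

namespace BWT

open FreeMonoid

/-! ### Elementary combinatorics of words -/

/-- Levi's lemma: two factorizations of the same word have a common refinement. -/
theorem levi {α : Type*} {a b c d : FreeMonoid α} (h : a * b = c * d) :
    (∃ t, c = a * t ∧ b = t * d) ∨ ∃ t, a = c * t ∧ d = t * b :=
  List.append_eq_append_iff.1 h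

theorem levi_left {α : Type*} {a b c d : FreeMonoid α} (h : a * b = c * d)
    (hl : a.length ≤ c.length) : ∃ t, c = a * t ∧ b = t * d := by
  rcases levi h with h' | ⟨t, h1, h2⟩
  · exact h'
  · have := congrArg FreeMonoid.length h1
    rw [length_mul] at this
    have ht : t = 1 := length_eq_zero.1 (by omega)
    subst ht
    exact ⟨1, by simpa using h1.symm, by simpa using h2.symm⟩

theorem mul_eq_mul_of_length {α : Type*} {a b c d : FreeMonoid α} (h : a * b = c * d)
    (hl : a.length = c.length) : a = c ∧ b = d := by
  obtain ⟨t, h1, h2⟩ := levi_left h hl.le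
  have := congrArg FreeMonoid.length h1
  rw [length_mul] at this
  have ht : t = 1 := length_eq_zero.1 (by omega)
  subst ht
  simp_all

theorem mul_eq_mul_of_length' {α : Type*} {a b c d : FreeMonoid α} (h : a * b = c * d)
    (hl : b.length = d.length) : a = c ∧ b = d := by
  refine mul_eq_mul_of_length h ?_
  have := congrArg FreeMonoid.length h
  simp only [length_mul] at this
  omega

theorem length_pow {α : Type*} (x : FreeMonoid α) (n : ℕ) : (x ^ n).length = n * x.length := by
  induction n with
  | zero => simp
  | succ n ih => rw [pow_succ, length_mul, ih]; ring

theorem length_pos_of_ne_one {α : Type*} {x : FreeMonoid α} (h : x ≠ 1) : 0 < x.length :=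
  Nat.pos_of_ne_zero fun h' => h (length_eq_zero.1 h')

theorem exists_of_mul {α : Type*} {x : FreeMonoid α} (h : x ≠ 1) : ∃ c y, x = of c * y := by
  induction x using FreeMonoid.casesOn with
  | one => exact absurd rfl h
  | of_mul c y => exact ⟨c, y, rfl⟩

theorem exists_mul_of {α : Type*} {x : FreeMonoid α} (h : x ≠ 1) : ∃ y c, x = y * of c := by
  rcases List.eq_nil_or_concat x.toList with h' | ⟨l, c, h'⟩
  · exact absurd h' h
  · exact ⟨ofList l, c, by
      apply toList.injective
      simpa using h'⟩

theorem induction_mul_of {α : Type*} {P : FreeMonoid α → Prop} (x : FreeMonoid α) (h1 : P 1)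
    (h : ∀ x c, P x → P (x * of c)) : P x :=
  List.reverseRecOn (motive := P) x h1 h

theorem mul_of_inj {α : Type*} {x y : FreeMonoid α} {c d : α} (h : x * of c = y * of d) :
    x = y ∧ c = d := by
  obtain ⟨h1, h2⟩ := mul_eq_mul_of_length' h (by simp)
  exact ⟨h1, of_injective h2⟩

theorem of_mul_inj {α : Type*} {x y : FreeMonoid α} {c d : α} (h : of c * x = of d * y) :
    c = d ∧ x = y := by
  obtain ⟨h1, h2⟩ := mul_eq_mul_of_length h (by simp)
  exact ⟨of_injective h1, h2⟩

/-- Of two words, one is a prefix of the other, or they differ at a first position. -/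
theorem prefix_or_mismatch {α : Type*} (u v : FreeMonoid α) :
    u ∣ v ∨ v ∣ u ∨ ∃ t c d u' v', c ≠ d ∧ u = t * of c * u' ∧ v = t * of d * v' := by
  induction u using FreeMonoid.inductionOn' generalizing v with
  | one => exact Or.inl (one_dvd _)
  | of_mul c u ih =>
    by_cases hv : v = 1
    · exact Or.inr (Or.inl (hv ▸ one_dvd _))
    obtain ⟨d, v, rfl⟩ := exists_of_mul hv
    by_cases hcd : c = d
    · subst hcd
      rcases ih v with h | h | ⟨t, e, f, u', v', hef, rfl, rfl⟩
      · exact Or.inl (mul_dvd_mul_left _ h)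
      · exact Or.inr (Or.inl (mul_dvd_mul_left _ h))
      · exact Or.inr (Or.inr ⟨of c * t, e, f, u', v', hef, by simp [mul_assoc], by simp [mul_assoc]⟩)
    · exact Or.inr (Or.inr ⟨1, c, d, u, v, hcd, by simp, by simp⟩)

/-- Conjugacy of words: `x` and `y` are rotations of each other. -/
def Conj {α : Type*} (x y : FreeMonoid α) : Prop :=
  ∃ g h, x = g * h ∧ y = h * g

theorem conj_iff_isRotated {α : Type*} {x y : FreeMonoid α} :
    Conj x y ↔ x.toList ~r y.toList := by
  constructor
  · rintro ⟨g, h, rfl, rfl⟩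
    exact List.isRotated_append
  · rintro ⟨n, hn⟩
    rw [← List.rotate_mod] at hn
    by_cases hx : x.toList.length = 0
    · have hx' := List.length_eq_zero_iff.1 hx
      rw [hx'] at hn
      exact ⟨1, 1, toList.injective (by simpa using hx'), toList.injective (by simpa using hn.symm)⟩
    rw [List.rotate_eq_drop_append_take (Nat.mod_lt _ (Nat.pos_of_ne_zero hx)).le] at hn
    refine ⟨ofList (x.toList.take (n % x.toList.length)), ofList (x.toList.drop (n % x.toList.length)),
      toList.injective ?_, toList.injective ?_⟩
    · simp
    · simpa using hn.symm

theorem Conj.refl {α : Type*} (x : FreeMonoid α) : Conj x x := ⟨1, x, by simp, by simp⟩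

theorem Conj.symm {α : Type*} {x y : FreeMonoid α} (h : Conj x y) : Conj y x := by
  obtain ⟨g, h, rfl, rfl⟩ := h
  exact ⟨h, g, rfl, rfl⟩

theorem Conj.trans {α : Type*} {x y z : FreeMonoid α} (h : Conj x y) (h' : Conj y z) :
    Conj x z := by
  rw [conj_iff_isRotated] at *
  exact h.trans h'

theorem Conj.map {α β : Type*} {x y : FreeMonoid α} (h : Conj x y)
    (μ : FreeMonoid α →* FreeMonoid β) : Conj (μ x) (μ y) := by
  obtain ⟨g, h, rfl, rfl⟩ := h
  exact ⟨μ g, μ h, map_mul .., map_mul ..⟩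

theorem Conj.length_eq {α : Type*} {x y : FreeMonoid α} (h : Conj x y) : x.length = y.length := by
  obtain ⟨g, h, rfl, rfl⟩ := h
  simp only [length_mul]; omega

theorem mul_pow_conj {α : Type*} (g h : FreeMonoid α) (n : ℕ) :
    g * (h * g) ^ n = (g * h) ^ n * g := by
  induction n with
  | zero => simp
  | succ n ih => rw [pow_succ', pow_succ', mul_assoc (g * h), ← ih]; simp only [mul_assoc]

/-- A word conjugate to a power is the same power of a conjugate of the base. -/
theorem Conj.exists_pow {α : Type*} {z y : FreeMonoid α} {n : ℕ} (h : Conj (z ^ n) y) :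
    ∃ z', Conj z z' ∧ y = z' ^ n := by
  rw [conj_iff_isRotated] at h
  obtain ⟨k, hk⟩ := h
  induction k generalizing y with
  | zero => exact ⟨z, Conj.refl z, toList.injective (by simpa using hk.symm)⟩
  | succ k ih =>
    obtain ⟨z', hz, hz'⟩ := ih (y := ofList ((z ^ n).toList.rotate k)) rfl
    rw [← List.rotate_rotate] at hk
    have hk' : z'^n = ofList ((z ^ n).toList.rotate k) := hz'.symm
    by_cases h1 : z' = 1
    · subst h1
      refine ⟨1, hz, toList.injective ?_⟩
      rw [← hk, show (z ^ n).toList.rotate k = (1 : FreeMonoid α).toList by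
        rw [one_pow] at hk'; exact hk'.symm]
      simp
    obtain ⟨c, t, rfl⟩ := exists_of_mul h1
    refine ⟨t * of c, hz.trans ⟨of c, t, rfl, rfl⟩, toList.injective ?_⟩
    rw [← hk, show (z ^ n).toList.rotate k = ((of c * t) ^ n).toList from congrArg toList hz']
    cases n with
    | zero => simp
    | succ n =>
      rw [pow_succ', mul_assoc, toList_of_mul, List.rotate_cons_succ, List.rotate_zero,
        pow_succ', show (t * of c * (t * of c) ^ n) = t * (of c * t) ^ n * of c by
        rw [mul_assoc t (of c), mul_pow_conj (of c) t, mul_assoc]]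
      simp

/-! ### Binary morphisms: the delay of the two letters -/

/-- `τ` is the longest common prefix of all sufficiently long images of words starting with
different letters, and the image of a word starting with `c` continues after `τ` with `E c`. -/
def IsSplit {α : Type*} (μ : FreeMonoid Bool →* FreeMonoid α) (τ : FreeMonoid α) (E : Bool → α) :
    Prop :=
  E false ≠ E true ∧
    ∀ c x, τ.length < (μ (of c * x)).length → τ * of (E c) ∣ μ (of c * x)

theorem ne_of_bool_ne {α : Type*} {E : Bool → α} (h : E false ≠ E true) {c d : Bool} (hcd : c ≠ d) :
    E c ≠ E d := by
  cases c <;> cases d <;> simp_all [eq_comm]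

theorem not_commute_iff {α : Type*} {f : Bool → FreeMonoid α} (c : Bool) :
    f false * f true ≠ f true * f false ↔ f c * f (!c) ≠ f (!c) * f c := by
  cases c <;> simp [eq_comm]

/-- The delay exists: while one image is a prefix of the other, the morphism factors through a
binary morphism with shorter images. -/
theorem exists_isSplit_lift {α : Type*} (n : ℕ) (f : Bool → FreeMonoid α)
    (hn : (f false).length + (f true).length ≤ n) (hf : f false * f true ≠ f true * f false) :
    ∃ τ E, IsSplit (lift f) τ E := by
  induction n generalizing f with
  | zero =>
    have h1 : f false = 1 := length_eq_zero.1 (by omega)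
    simp [h1] at hf
  | succ n ih =>
    by_cases hd : ∃ c, f c ∣ f (!c)
    · -- a Euclidean step: factor the longer image through the shorter one
      obtain ⟨c, v, hv⟩ := hd
      rw [not_commute_iff c] at hf
      have hc1 : f c ≠ 1 := fun h => hf (by simp [h])
      let f' : Bool → FreeMonoid α := fun d => if d = c then f c else v
      let θ : FreeMonoid Bool →* FreeMonoid Bool :=
        lift fun d => if d = c then of c else of c * of (!c)
      have hfc : f' c = f c := by simp [f']
      have hfc' : f' (!c) = v := by simp [f']
      have hcomp : lift f = (lift f').comp θ := by
        refine hom_eq fun d => ?_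
        by_cases h : d = c
        · subst h; simp [θ, hfc]
        · have : d = !c := by cases c <;> cases d <;> simp_all
          subst this
          simp [θ, hfc, hfc', hv]
      have hθ : ∀ x, x ≠ 1 → ∃ y, θ x = of c * y := by
        intro x hx
        obtain ⟨d, y, rfl⟩ := exists_of_mul hx
        by_cases h : d = c
        · exact ⟨θ y, by simp [θ, h]⟩
        · exact ⟨of (!c) * θ y, by simp [θ, h, mul_assoc]⟩
      obtain ⟨τ, E, hE, hτ⟩ := ih f' (by
          have h1 := length_pos_of_ne_one hc1
          have h2 := congrArg FreeMonoid.length hv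
          rw [length_mul] at h2
          have h3 : (f' false).length + (f' true).length = (f c).length + v.length := by
            cases c <;> simp [f', add_comm]
          have h4 : (f false).length + (f true).length = (f c).length + (f (!c)).length := by
            cases c <;> simp [add_comm]
          omega) (by
          rw [not_commute_iff c, hfc, hfc']
          intro h
          apply hf
          rw [hv, mul_assoc, ← h])
      refine ⟨f c * τ, E, hE, fun d x hx => ?_⟩
      have hstep : ∃ y, lift f (of d * x) = f c * lift f' (of d * y) := by
        by_cases h : d = c
        · subst h
          have hx1 : x ≠ 1 := by
            rintro rfl
            simp at hx
          obtain ⟨y, hy⟩ := hθ x hx1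
          refine ⟨y, ?_⟩
          rw [map_mul, ← hy, hcomp]
          simp [θ, hfc]
        · have : d = !c := by cases c <;> cases d <;> simp_all
          subst this
          refine ⟨θ x, ?_⟩
          rw [map_mul, map_mul, hcomp]
          simp [θ, hfc, hfc', mul_assoc]
      obtain ⟨y, hy⟩ := hstep
      rw [hy, mul_assoc]
      rw [hy, length_mul, length_mul] at hx
      exact mul_dvd_mul_left _ (hτ d y (by omega))
    · push Not at hd
      rcases prefix_or_mismatch (f false) (f true) with h | h | ⟨t, c, d, u, v, hcd, hu, hv⟩
      · exact absurd h (hd false)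
      · exact absurd h (hd true)
      · refine ⟨t, fun e => if e then d else c, by simpa using hcd, fun e x _ => ?_⟩
        rw [map_mul, lift_eval_of]
        cases e
        · rw [hu]; exact Dvd.dvd.mul_right (by simp) _
        · rw [hv]; exact Dvd.dvd.mul_right (by simp) _

/-- The images of the two letters under a binary morphism do not commute. -/
def Noncomm {α : Type*} (μ : FreeMonoid Bool →* FreeMonoid α) : Prop :=
  μ (of false) * μ (of true) ≠ μ (of true) * μ (of false)

theorem Noncomm.exists_isSplit {α : Type*} {μ : FreeMonoid Bool →* FreeMonoid α}
    (h : Noncomm μ) : ∃ τ E, IsSplit μ τ E := by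
  have := exists_isSplit_lift _ (μ ∘ of) le_rfl h
  rwa [lift_restrict] at this

theorem Noncomm.ne_one {α : Type*} {μ : FreeMonoid Bool →* FreeMonoid α}
    (h : Noncomm μ) (c : Bool) : μ (of c) ≠ 1 := by
  intro h'
  apply h
  cases c <;> simp [h']

theorem Noncomm.length_le {α : Type*} {μ : FreeMonoid Bool →* FreeMonoid α}
    (h : Noncomm μ) (x : FreeMonoid Bool) : x.length ≤ (μ x).length := by
  induction x using FreeMonoid.inductionOn' with
  | one => simp
  | of_mul c x ih =>
    have := length_pos_of_ne_one (h.ne_one c)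
    simp only [map_mul, length_mul, length_of]
    omega

/-- The images of the two letters end with different letters. -/
def LastDiffer {α : Type*} (μ : FreeMonoid Bool →* FreeMonoid α) : Prop :=
  ∃ E : Bool → α, E false ≠ E true ∧ ∀ c, ∃ g, μ (of c) = g * of (E c)

theorem LastDiffer.noncomm {α : Type*} {μ : FreeMonoid Bool →* FreeMonoid α}
    (h : LastDiffer μ) : Noncomm μ := by
  obtain ⟨E, hE, hg⟩ := h
  obtain ⟨g, hg0⟩ := hg false
  obtain ⟨g', hg1⟩ := hg true
  intro h
  rw [hg0, hg1, ← mul_assoc, ← mul_assoc] at h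
  exact hE (mul_of_inj h).2.symm

/-- Every binary morphism with non-commuting images is conjugate to one whose images end with
different letters: the longest common suffix `σ` of long images is moved to the front. -/
theorem Noncomm.exists_conj {α : Type*} {μ : FreeMonoid Bool →* FreeMonoid α}
    (h : Noncomm μ) : ∃ (μ' : FreeMonoid Bool →* FreeMonoid α) (σ : FreeMonoid α),
      LastDiffer μ' ∧ ∀ x, σ * μ x = μ' x * σ := by
  let ρ : FreeMonoid Bool →* FreeMonoid α := lift fun c => reverse (μ (of c))
  have hρ : ∀ x, ρ (reverse x) = reverse (μ x) := by
    intro x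
    induction x using FreeMonoid.inductionOn' with
    | one => simp [show reverse (1 : FreeMonoid Bool) = 1 from rfl,
        show reverse (1 : FreeMonoid α) = 1 from rfl]
    | of_mul c x ih => simp [reverse_mul, ih, ρ, reverse_of]
  have hρn : Noncomm ρ := by
    intro h'
    apply h
    have := congrArg reverse h'
    simpa [ρ, reverse_mul] using this.symm
  obtain ⟨τ, E, hE, hτ⟩ := hρn.exists_isSplit
  have hsuf : ∀ c x, τ.length < (μ (x * of c)).length →
      ∃ t, μ (x * of c) = t * of (E c) * reverse τ := by
    intro c x hx
    obtain ⟨t, ht⟩ := hτ c (reverse x) (by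
      rw [← reverse_of c, ← reverse_mul, hρ, length_reverse]; exact hx)
    refine ⟨reverse t, ?_⟩
    rw [← reverse_of c, ← reverse_mul, hρ] at ht
    have := congrArg reverse ht
    simpa [reverse_mul, mul_assoc] using this
  have hg : ∀ c, ∃ g, reverse τ * μ (of c) = g * of (E c) * reverse τ := by
    intro c
    have hlong := h.length_le (of false ^ (τ.length + 1))
    rw [length_pow, length_of, mul_one] at hlong
    obtain ⟨t, ht⟩ := hsuf false (of false ^ τ.length) (by rw [← pow_succ]; omega)
    obtain ⟨t', ht'⟩ := hsuf c (of false ^ τ.length * of false)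
      (by rw [← pow_succ, map_mul, length_mul]; omega)
    rw [map_mul, ht] at ht'
    have hpos := length_pos_of_ne_one (h.ne_one c)
    have hlen := congrArg FreeMonoid.length ht'
    simp only [length_mul, length_of, length_reverse] at hlen
    rw [mul_assoc (t * _), mul_assoc t', eq_comm] at ht'
    obtain ⟨s, -, hs⟩ := levi_left (a := t * of (E false)) (b := reverse τ * μ (of c)) ht'.symm
      (by simp only [length_mul, length_of]; omega)
    exact ⟨s, by rw [hs, mul_assoc]⟩
  choose g hg using hg
  refine ⟨lift fun c => g c * of (E c), reverse τ, ⟨E, hE, fun c => ⟨g c, by simp⟩⟩, fun x => ?_⟩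
  induction x using FreeMonoid.inductionOn' with
  | one => simp
  | of_mul c x ih =>
    rw [map_mul, ← mul_assoc, hg, mul_assoc, ih, map_mul, lift_eval_of]
    simp only [mul_assoc]

/-- Uniqueness of parsing from the right for a morphism whose images end with different letters:
a word has at most one factorization into a non-empty suffix of an image of a letter and a product
of images of letters. -/
theorem LastDiffer.parse_unique {α : Type*} {μ : FreeMonoid Bool →* FreeMonoid α}
    (h : LastDiffer μ) {c d : Bool} {p s p' s' : FreeMonoid α} {x y : FreeMonoid Bool}
    (hs : s ≠ 1) (hs' : s' ≠ 1) (hc : μ (of c) = p * s) (hd : μ (of d) = p' * s')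
    (hxy : s * μ x = s' * μ y) : c = d ∧ s = s' ∧ x = y := by
  obtain ⟨E, hE, hg⟩ := h
  have hlast : ∀ {c e : Bool} {p s t : FreeMonoid α}, s ≠ 1 → μ (of c) = p * s → s = t * μ (of e) →
      t = 1 ∧ c = e := by
    intro c e p s t hs hc ht
    obtain ⟨g, hg1⟩ := hg c
    obtain ⟨g', hg2⟩ := hg e
    have hce : c = e := by
      by_contra hne
      rw [ht, hg1, hg2, ← mul_assoc, ← mul_assoc] at hc
      exact ne_of_bool_ne hE hne (mul_of_inj hc).2
    subst hce
    have := congrArg FreeMonoid.length hc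
    rw [ht, length_mul, length_mul] at this
    exact ⟨length_eq_zero.1 (by omega), rfl⟩
  induction x using induction_mul_of generalizing y with
  | h1 =>
    by_cases hy : y = 1
    · subst hy
      simp only [map_one, mul_one] at hxy
      subst hxy
      obtain ⟨t, l, rfl⟩ := exists_mul_of hs
      obtain ⟨g, hg1⟩ := hg c
      obtain ⟨g', hg2⟩ := hg d
      refine ⟨?_, rfl, rfl⟩
      by_contra hne
      rw [hg1, ← mul_assoc] at hc
      rw [hg2, ← mul_assoc] at hd
      exact ne_of_bool_ne hE hne ((mul_of_inj hc).2.trans (mul_of_inj hd).2.symm)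
    · obtain ⟨y, e, rfl⟩ := exists_mul_of hy
      rw [map_one, mul_one, map_mul, ← mul_assoc] at hxy
      have := (hlast hs hc hxy).1
      have h2 := congrArg FreeMonoid.length this
      have := length_pos_of_ne_one hs'
      rw [length_mul, length_one] at h2
      omega
  | h x e ih =>
    by_cases hy : y = 1
    · subst hy
      rw [map_one, mul_one, map_mul, ← mul_assoc] at hxy
      have := (hlast hs' hd hxy.symm).1
      have h2 := congrArg FreeMonoid.length this
      have := length_pos_of_ne_one hs
      rw [length_mul, length_one] at h2
      omega
    · obtain ⟨y, e', rfl⟩ := exists_mul_of hy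
      have hee : e = e' := by
        by_contra hne
        obtain ⟨g, hg1⟩ := hg e
        obtain ⟨g', hg2⟩ := hg e'
        rw [map_mul, map_mul, hg1, hg2] at hxy
        simp only [← mul_assoc] at hxy
        exact ne_of_bool_ne hE hne (mul_of_inj hxy).2
      subst hee
      rw [map_mul, map_mul, ← mul_assoc, ← mul_assoc] at hxy
      obtain ⟨h1, h2, h3⟩ := ih (mul_right_cancel hxy)
      exact ⟨h1, h2, by rw [h3]⟩

theorem LastDiffer.injective {α : Type*} {μ : FreeMonoid Bool →* FreeMonoid α}
    (h : LastDiffer μ) : Function.Injective μ := by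
  intro x y hxy
  have h1 := h.noncomm.ne_one true
  exact (h.parse_unique (p := 1) (p' := 1) (c := true) (d := true) h1 h1 (by simp) (by simp)
    (by rw [hxy])).2.2

/-- A binary morphism is injective as soon as the images of the letters do not commute. -/
theorem Noncomm.injective {α : Type*} {μ : FreeMonoid Bool →* FreeMonoid α}
    (h : Noncomm μ) : Function.Injective μ := by
  obtain ⟨μ', σ, h', hσ⟩ := h.exists_conj
  intro x y hxy
  apply h'.injective
  apply mul_right_cancel (b := σ)
  rw [← hσ, ← hσ, hxy]

theorem noncomm_of_injective {α : Type*} {μ : FreeMonoid Bool →* FreeMonoid α}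
    (h : Function.Injective μ) : Noncomm μ := by
  intro h'
  rw [← map_mul, ← map_mul] at h'
  have := (of_mul_inj (h h')).1
  simp at this

/-! ### Commutation and primitive roots -/

/-- Two words satisfying a non-trivial relation commute. -/
theorem commute_of_relation {α : Type*} {p q : FreeMonoid α} {x y : FreeMonoid Bool} (hxy : x ≠ y)
    (h : lift (fun c => bif c then q else p) x = lift (fun c => bif c then q else p) y) :
    p * q = q * p := by
  by_contra hne
  exact hxy (Noncomm.injective (μ := lift fun c => bif c then q else p) (by simpa [Noncomm]) h)

theorem exists_common_root {α : Type*} (n : ℕ) {p q : FreeMonoid α} (hn : p.length + q.length ≤ n)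
    (h : p * q = q * p) : ∃ z i j, p = z ^ i ∧ q = z ^ j := by
  induction n generalizing p q with
  | zero =>
    exact ⟨1, 0, 0, by simp [length_eq_zero.1 (show p.length = 0 by omega)],
      by simp [length_eq_zero.1 (show q.length = 0 by omega)]⟩
  | succ n ih =>
    by_cases hp : p = 1
    · exact ⟨q, 0, 1, by simp [hp], by simp⟩
    by_cases hq : q = 1
    · exact ⟨p, 1, 0, by simp, by simp [hq]⟩
    have hp' := length_pos_of_ne_one hp
    have hq' := length_pos_of_ne_one hq
    rcases levi h with ⟨t, h1, h2⟩ | ⟨t, h1, h2⟩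
    · subst h1
      rw [length_mul] at hn
      obtain ⟨z, i, j, hi, hj⟩ := ih (p := p) (q := t) (by omega) h2
      exact ⟨z, i, i + j, hi, by rw [pow_add, ← hi, ← hj]⟩
    · subst h1
      rw [length_mul] at hn
      obtain ⟨z, i, j, hi, hj⟩ := ih (p := q) (q := t) (by omega) h2
      exact ⟨z, i + j, i, by rw [pow_add, ← hi, ← hj], hi⟩

theorem IsPrimitive.eq_of_eq_pow {α : Type*} {p z : FreeMonoid α} {i : ℕ} (hp : IsPrimitive p)
    (h : p = z ^ i) : p = z := by
  have hz : z ≠ 1 := by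
    rintro rfl
    exact hp.1 (by simpa using h)
  have := hp.2 z hz i h
  subst this
  simpa using h

theorem IsPrimitive.eq_of_commute {α : Type*} {p q : FreeMonoid α} (hp : IsPrimitive p)
    (h : p * q = q * p) : ∃ k, q = p ^ k := by
  obtain ⟨z, i, j, hi, hj⟩ := exists_common_root _ le_rfl h
  exact ⟨j, by rw [hp.eq_of_eq_pow hi]; exact hj⟩

theorem IsPrimitive.eq_of_pow_eq_pow {α : Type*} {p q : FreeMonoid α} (hp : IsPrimitive p)
    (hq : IsPrimitive q) {m n : ℕ} (hm : m ≠ 0) (h : p ^ m = q ^ n) : p = q := by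
  have hne : (of false : FreeMonoid Bool) ^ m ≠ of true ^ n := by
    intro h'
    obtain ⟨m, rfl⟩ := Nat.exists_eq_succ_of_ne_zero hm
    have hl := congrArg FreeMonoid.length h'
    rw [length_pow, length_pow] at hl
    simp only [length_of, mul_one] at hl
    subst hl
    rw [Nat.succ_eq_add_one, pow_succ', pow_succ'] at h'
    simpa using (of_mul_inj h').1
  have := commute_of_relation (p := p) (q := q) hne (by simpa using h)
  obtain ⟨k, hk⟩ := hp.eq_of_commute this
  exact (hq.eq_of_eq_pow hk).symm

theorem commute_of_commute_pow {α : Type*} {p q : FreeMonoid α} {n : ℕ} (hn : n ≠ 0)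
    (h : p * q ^ n = q ^ n * p) : p * q = q * p := by
  refine commute_of_relation (x := of false * of true ^ n) (y := of true ^ n * of false) ?_
    (by simpa using h)
  obtain ⟨n, rfl⟩ := Nat.exists_eq_succ_of_ne_zero hn
  intro h'
  rw [Nat.succ_eq_add_one, pow_succ', mul_assoc] at h'
  simpa using (of_mul_inj h').1

theorem exists_primitive_root {α : Type*} (x : FreeMonoid α) (hx : x ≠ 1) :
    ∃ p n, IsPrimitive p ∧ n ≠ 0 ∧ x = p ^ n := by
  induction hl : x.length using Nat.strong_induction_on generalizing x with
  | _ l ih =>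
    by_cases hp : IsPrimitive x
    · exact ⟨x, 1, hp, by simp, by simp⟩
    · simp only [IsPrimitive, not_and, not_forall] at hp
      obtain ⟨u, hu, k, hk, hk1⟩ := hp hx
      have hk0 : k ≠ 0 := by
        rintro rfl
        exact hx (by simpa using hk)
      have hlen := congrArg FreeMonoid.length hk
      rw [length_pow] at hlen
      have hupos := length_pos_of_ne_one hu
      obtain ⟨p, n, hp, hn, hpn⟩ := ih u.length (by
        have : 2 ≤ k := by omega
        nlinarith) u hu rfl
      exact ⟨p, n * k, hp, by positivity, by rw [hk, hpn, pow_mul]⟩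

theorem Conj.isPrimitive {α : Type*} {x y : FreeMonoid α} (h : Conj x y) (hx : IsPrimitive x) :
    IsPrimitive y := by
  refine ⟨?_, fun u hu k hk => ?_⟩
  · rintro rfl
    exact hx.1 (length_eq_zero.1 (by simpa using h.length_eq))
  · obtain ⟨z, hz, hz'⟩ := (hk ▸ h.symm).exists_pow
    refine hx.2 z ?_ k hz'
    rintro rfl
    exact hu (length_eq_zero.1 (by simpa using hz.length_eq))

/-! ### Branching words of prefix-closed languages -/

/-- In a prefix-closed binary language the number of words of a given length exceeds the number
of shorter branching words by at most one. -/
theorem ncard_le_branching (T : Set (FreeMonoid Bool)) (hT : ∀ f c, f * of c ∈ T → f ∈ T) (n : ℕ) :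
    {f | f ∈ T ∧ f.length = n}.ncard ≤
      1 + {f | f.length < n ∧ f * of false ∈ T ∧ f * of true ∈ T}.ncard := by
  have hfin : ∀ (S : Set (FreeMonoid Bool)) n, (∀ f ∈ S, f.length ≤ n) → S.Finite :=
    fun S n h => (List.finite_length_le Bool n).subset h
  induction n with
  | zero =>
    refine le_trans (Set.ncard_le_ncard (t := {1}) ?_) (by simp)
    rintro f ⟨-, hf⟩
    exact length_eq_zero.1 hf
  | succ n ih =>
    let F : Bool → Set (FreeMonoid Bool) := fun c => {f | f.length = n ∧ f * of c ∈ T}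
    have hF : ∀ c, (F c).Finite := fun c => hfin _ n fun f hf => hf.1.le
    have h1 : {f | f ∈ T ∧ f.length = n + 1} ⊆
        (fun f => f * of false) '' F false ∪ (fun f => f * of true) '' F true := by
      rintro f ⟨hf, hl⟩
      obtain ⟨g, c, rfl⟩ := exists_mul_of (x := f) (by rintro rfl; simp at hl)
      simp only [length_mul, length_of, add_left_inj] at hl
      cases c
      · exact Or.inl ⟨g, ⟨hl, hf⟩, rfl⟩
      · exact Or.inr ⟨g, ⟨hl, hf⟩, rfl⟩
    have h2 := Set.ncard_le_ncard h1 (((hF _).image _).union ((hF _).image _))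
    have h3 := Set.ncard_union_le ((fun f => f * of false) '' F false)
      ((fun f => f * of true) '' F true)
    have h4 := Set.ncard_image_le (f := fun f => f * of false) (hF false)
    have h5 := Set.ncard_image_le (f := fun f => f * of true) (hF true)
    have h6 := Set.ncard_union_add_ncard_inter (F false) (F true) (hF _) (hF _)
    have h7 : (F false ∪ F true).ncard ≤ {f | f ∈ T ∧ f.length = n}.ncard := by
      refine Set.ncard_le_ncard ?_ (hfin _ n fun f hf => hf.2.le)
      rintro f (⟨h, h'⟩ | ⟨h, h'⟩) <;> exact ⟨hT _ _ h', h⟩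
    have h8 : {f | f.length < n ∧ f * of false ∈ T ∧ f * of true ∈ T}.ncard +
        (F false ∩ F true).ncard ≤
        {f | f.length < n + 1 ∧ f * of false ∈ T ∧ f * of true ∈ T}.ncard := by
      rw [← Set.ncard_union_eq ?_ (hfin _ n fun f hf => hf.1.le)
        (hfin _ n fun f hf => hf.1.1.le)]
      · refine Set.ncard_le_ncard ?_ (hfin _ n fun f hf => Nat.lt_succ_iff.1 hf.1)
        rintro f (⟨h, h'⟩ | ⟨⟨h, h'⟩, -, h''⟩)
        · exact ⟨h.trans n.lt_succ_self, h'⟩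
        · exact ⟨by omega, h', h''⟩
      · rw [Set.disjoint_left]
        rintro f ⟨h, -⟩ ⟨⟨h', -⟩, -⟩
        omega
    omega

/-- In a prefix-closed language in which every word can be extended, the number of words of a
given length exceeds the number of shorter branching words by at least one. -/
theorem branching_lt_ncard {α : Type*} (P : Set (FreeMonoid α)) (h1 : (1 : FreeMonoid α) ∈ P)
    (hext : ∀ f ∈ P, ∃ c, f * of c ∈ P) (hpre : ∀ f c, f * of c ∈ P → f ∈ P)
    (hfin : ∀ n, {f | f ∈ P ∧ f.length = n}.Finite) (n : ℕ) :
    {f | f.length < n ∧ ∃ c d, c ≠ d ∧ f * of c ∈ P ∧ f * of d ∈ P}.Finite ∧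
    {f | f.length < n ∧ ∃ c d, c ≠ d ∧ f * of c ∈ P ∧ f * of d ∈ P}.ncard <
      {f | f ∈ P ∧ f.length = n}.ncard := by
  induction n with
  | zero =>
    simp only [not_lt_zero, false_and, Set.ofPred_false, Set.finite_empty, Set.ncard_empty, true_and]
    exact (Set.ncard_pos (hfin 0)).2 ⟨1, h1, by simp⟩
  | succ n ih =>
    obtain ⟨ih1, ih2⟩ := ih
    let B : Set (FreeMonoid α) := {f | f.length = n ∧ ∃ c d, c ≠ d ∧ f * of c ∈ P ∧ f * of d ∈ P}
    have hB : B ⊆ {f | f ∈ P ∧ f.length = n} := by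
      rintro f ⟨hl, c, d, -, h, -⟩
      exact ⟨hpre _ _ h, hl⟩
    have hBfin := (hfin n).subset hB
    have heq : {f | f.length < n + 1 ∧ ∃ c d, c ≠ d ∧ f * of c ∈ P ∧ f * of d ∈ P} =
        {f | f.length < n ∧ ∃ c d, c ≠ d ∧ f * of c ∈ P ∧ f * of d ∈ P} ∪ B := by
      ext f
      simp only [Nat.lt_succ_iff_lt_or_eq, Set.mem_ofPred_eq, Set.mem_union, B]
      exact or_and_right
    rw [heq]
    refine ⟨ih1.union hBfin, ?_⟩
    have hch : ∀ f : FreeMonoid α, ∃ c, f ∈ P → f * of c ∈ P := fun f => by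
      by_cases hf : f ∈ P
      · obtain ⟨c, hc⟩ := hext f hf
        exact ⟨c, fun _ => hc⟩
      · obtain ⟨c, -⟩ := hext 1 h1
        exact ⟨c, fun h => absurd h hf⟩
    choose e he using hch
    have hch' : ∀ f : FreeMonoid α, ∃ c, f ∈ B → f * of c ∈ P ∧ c ≠ e f := fun f => by
      by_cases hf : f ∈ B
      · obtain ⟨-, c, d, hcd, hc, hd⟩ := id hf
        by_cases h : c = e f
        · exact ⟨d, fun _ => ⟨hd, fun h' => hcd (h.trans h'.symm)⟩⟩
        · exact ⟨c, fun _ => ⟨hc, h⟩⟩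
      · exact ⟨e f, fun h => absurd h hf⟩
    choose e' he' using hch'
    have hsub : (fun f => f * of (e f)) '' {f | f ∈ P ∧ f.length = n} ∪
        (fun f => f * of (e' f)) '' B ⊆ {f | f ∈ P ∧ f.length = n + 1} := by
      rintro _ (⟨f, ⟨hf, hl⟩, rfl⟩ | ⟨f, hf, rfl⟩)
      · exact ⟨he f hf, by simp [hl]⟩
      · exact ⟨(he' f hf).1, by simp [hf.1]⟩
    have hle := Set.ncard_le_ncard hsub (hfin _)
    rw [Set.ncard_union_eq ?_ ((hfin n).image _) (hBfin.image _),
      Set.InjOn.ncard_image fun f _ g _ h => (mul_of_inj h).1,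
      Set.InjOn.ncard_image fun f _ g _ h => (mul_of_inj h).1] at hle
    · have := Set.ncard_union_le
        {f | f.length < n ∧ ∃ c d, c ≠ d ∧ f * of c ∈ P ∧ f * of d ∈ P} B
      omega
    · rw [Set.disjoint_left]
      rintro _ ⟨f, hf, rfl⟩ ⟨g, hg, h⟩
      obtain ⟨rfl, h'⟩ := mul_of_inj h
      exact (he' g hg).2 h'

/-! ### Factors of periodic words -/

/-- The factors of the powers of `w`. -/
def Fac {α : Type*} (w : FreeMonoid α) : Set (FreeMonoid α) :=
  {f | ∃ m p q, w ^ m = p * f * q}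

theorem Fac.of_mul {α : Type*} {w p f q : FreeMonoid α} (h : p * f * q ∈ Fac w) : f ∈ Fac w := by
  obtain ⟨m, a, b, h⟩ := h
  exact ⟨m, a * p, q * b, by rw [h]; simp only [mul_assoc]⟩

theorem Fac.left {α : Type*} {w f q : FreeMonoid α} (h : f * q ∈ Fac w) : f ∈ Fac w :=
  Fac.of_mul (p := 1) (q := q) (by simpa using h)

theorem Fac.right {α : Type*} {w p f : FreeMonoid α} (h : p * f ∈ Fac w) : f ∈ Fac w :=
  Fac.of_mul (p := p) (q := 1) (by simpa using h)

theorem Fac.extend {α : Type*} {w f : FreeMonoid α} (hw : w ≠ 1) (h : f ∈ Fac w) (n : ℕ) :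
    ∃ q, f * q ∈ Fac w ∧ n ≤ q.length := by
  obtain ⟨m, p, q, h⟩ := h
  refine ⟨q * w ^ n, ⟨m + n, p, 1, by rw [pow_add, h]; simp only [mul_assoc, mul_one]⟩, ?_⟩
  rw [length_mul, length_pow]
  have := length_pos_of_ne_one hw
  nlinarith

theorem Fac.exists_extend {α : Type*} {w f : FreeMonoid α} (hw : w ≠ 1) (h : f ∈ Fac w) :
    ∃ c, f * of c ∈ Fac w := by
  obtain ⟨q, hq, hl⟩ := Fac.extend hw h 1
  obtain ⟨c, q, rfl⟩ := exists_of_mul (x := q) (by rintro rfl; simp at hl)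
  rw [← mul_assoc] at hq
  exact ⟨c, Fac.left hq⟩

theorem Fac.conj {α : Type*} {w w' f : FreeMonoid α} (h : Conj w w') (hf : f ∈ Fac w) :
    f ∈ Fac w' := by
  obtain ⟨g, h, rfl, rfl⟩ := h
  obtain ⟨m, p, q, hf⟩ := hf
  refine ⟨m + 1, h * p, q * g, ?_⟩
  rw [pow_succ, ← mul_assoc, ← mul_pow_conj h g, hf]
  simp only [mul_assoc]

theorem Fac.map {α β : Type*} {w f : FreeMonoid α} (h : f ∈ Fac w)
    (μ : FreeMonoid α →* FreeMonoid β) : μ f ∈ Fac (μ w) := by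
  obtain ⟨m, p, q, h⟩ := h
  exact ⟨m, μ p, μ q, by rw [← map_pow, h, map_mul, map_mul]⟩

theorem exists_prefix_pow {α : Type*} {w p r : FreeMonoid α} {m : ℕ} (hw : w ≠ 1)
    (h : w ^ m = p * r) : ∃ j p', p = w ^ j * p' ∧ p'.length < w.length ∧ w ^ (m - j) = p' * r := by
  have hpos := length_pos_of_ne_one hw
  induction m generalizing p with
  | zero =>
    have := congrArg FreeMonoid.length h
    simp only [pow_zero, length_one, length_mul] at this
    have hp : p = 1 := length_eq_zero.1 (by omega)
    exact ⟨0, 1, by simp [hp], by simpa using hpos, by simpa [hp] using h⟩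
  | succ m ih =>
    by_cases hl : p.length < w.length
    · exact ⟨0, p, by simp, hl, by simpa using h⟩
    · rw [pow_succ'] at h
      obtain ⟨t, h1, h2⟩ := levi_left h (by omega)
      obtain ⟨j, p', hj, hl', hr⟩ := ih h2
      exact ⟨j + 1, p', by rw [h1, hj, pow_succ', mul_assoc], hl',
        by rw [Nat.add_sub_add_right]; exact hr⟩

theorem Fac.ncard_le {α : Type*} {w : FreeMonoid α} (hw : w ≠ 1) (n : ℕ) :
    {f | f ∈ Fac w ∧ f.length = n}.Finite ∧ {f | f ∈ Fac w ∧ f.length = n}.ncard ≤ w.length := by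
  have hpos := length_pos_of_ne_one hw
  let e : ℕ → FreeMonoid α := fun i => ofList (((w ^ (n + 1)).toList.drop i).take n)
  have hsub : {f | f ∈ Fac w ∧ f.length = n} ⊆ e '' (Finset.range w.length : Set ℕ) := by
    rintro f ⟨⟨m, p, q, h⟩, hl⟩
    rw [mul_assoc] at h
    obtain ⟨j, p', hj, hlt, hr⟩ := exists_prefix_pow hw h
    have h1 : p' * f * (q * w ^ (n + 1)) = w ^ (n + 1) * w ^ (m - j) := by
      rw [pow_mul_comm, hr]
      simp only [mul_assoc]
    obtain ⟨t, ht, -⟩ := levi_left h1 (by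
      rw [length_mul, length_pow]
      nlinarith)
    refine ⟨p'.length, by simpa using hlt, ?_⟩
    apply toList.injective
    have : (w ^ (n + 1)).toList = p'.toList ++ (f.toList ++ t.toList) := by
      rw [ht]; simp
    simp only [e, toList_ofList, this]
    rw [show p'.length = p'.toList.length from rfl, List.drop_left,
      show n = f.toList.length from hl.symm, List.take_left]
  refine ⟨(Set.toFinite _).subset hsub, ?_⟩
  refine (Set.ncard_le_ncard hsub (Set.toFinite _)).trans ((Set.ncard_image_le
    (Set.toFinite _)).trans ?_)
  simp

/-- A word of length `n` has at most `n - 1` branching factors in its periodic repetition. -/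
theorem Fac.branching_lt {α : Type*} {w : FreeMonoid α} (hw : w ≠ 1) (R : Finset (FreeMonoid α))
    (hR : ∀ f ∈ R, ∃ c d, c ≠ d ∧ f * of c ∈ Fac w ∧ f * of d ∈ Fac w) : R.card < w.length := by
  obtain ⟨h1, h2⟩ := branching_lt_ncard (Fac w) ⟨0, 1, 1, by simp⟩
    (fun f hf => Fac.exists_extend hw hf) (fun f c h => Fac.left h)
    (fun n => (Fac.ncard_le hw n).1) (R.sup FreeMonoid.length + 1)
  rw [← Set.ncard_coe_finset]
  refine (Set.ncard_le_ncard (fun f hf => ?_) h1).trans_lt (h2.trans_le (Fac.ncard_le hw _).2)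
  exact ⟨Nat.lt_succ_iff.2 (Finset.le_sup (f := FreeMonoid.length) hf), hR f hf⟩

/-! ### Images of non-conjugate words are not conjugate -/

theorem length_map_eq_sum {α : Type*} (μ : FreeMonoid Bool →* FreeMonoid α)
    (x : FreeMonoid Bool) :
    (μ x).length = ∑ c : Bool, x.toList.count c * (μ (of c)).length := by
  induction x using FreeMonoid.inductionOn' with
  | one => simp
  | of_mul c x ih =>
    rw [map_mul, length_mul, ih]
    cases c <;> simp <;> ring

/-- A primitive word has pairwise different rotations. -/
theorem IsPrimitive.rotate_inj {α : Type*} {x : FreeMonoid α} (hx : IsPrimitive x) {i j : ℕ}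
    (hi : i < x.length) (hj : j < x.length) (h : x.toList.rotate i = x.toList.rotate j) :
    i = j := by
  wlog hij : i < j generalizing i j
  · rcases lt_trichotomy i j with h' | h' | h'
    · exact absurd h' hij
    · exact h'
    · exact (this hj hi h.symm h').symm
  exfalso
  obtain ⟨k, rfl⟩ := Nat.exists_eq_add_of_lt hij
  have hz : IsPrimitive (ofList (x.toList.rotate i)) :=
    (conj_iff_isRotated.2 ⟨i, rfl⟩ : Conj x _).isPrimitive hx
  set z : FreeMonoid α := ofList (x.toList.rotate i) with hzdef
  have hlen : z.toList.length = x.length := by simp [hzdef, FreeMonoid.length]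
  have hk : z.toList.rotate (k + 1) = z.toList := by
    rw [hzdef, toList_ofList, List.rotate_rotate, h, add_assoc]
  rw [List.rotate_eq_drop_append_take (by omega)] at hk
  have h1 : z = ofList (z.toList.take (k + 1)) * ofList (z.toList.drop (k + 1)) :=
    toList.injective (by simp)
  have h2 : z = ofList (z.toList.drop (k + 1)) * ofList (z.toList.take (k + 1)) :=
    toList.injective (by simpa using hk.symm)
  obtain ⟨ζ, a, b, ha, hb⟩ := exists_common_root _ le_rfl (h1.symm.trans h2)
  rw [ha, hb, ← pow_add] at h1
  have hζ : ζ ≠ 1 := by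
    rintro h'
    rw [h', one_pow] at h1
    exact hz.1 h1
  have hab := hz.2 ζ hζ _ h1
  have h3 := congrArg FreeMonoid.length ha
  have h4 := congrArg FreeMonoid.length hb
  rw [length_pow] at h3 h4
  simp only [FreeMonoid.length, toList_ofList, List.length_take, List.length_drop] at h3 h4 hlen hj
  rcases (by omega : a = 0 ∨ b = 0) with h | h
  · rw [h, zero_mul] at h3; omega
  · rw [h, zero_mul] at h4; omega

theorem finite_conj {α : Type*} (x : FreeMonoid α) : {y | Conj x y}.Finite := by
  refine (List.finite_toSet (x.toList.cyclicPermutations)).subset fun y hy => ?_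
  exact List.mem_cyclicPermutations_iff.2 (conj_iff_isRotated.1 hy).symm

/-- A primitive word has as many rotations starting with `c` as it has occurrences of `c`. -/
theorem IsPrimitive.count_le {x : FreeMonoid Bool} (hx : IsPrimitive x) (c : Bool) :
    x.toList.count c ≤ {y | Conj x y ∧ ∃ t, y = of c * t}.ncard := by
  have h1 : x.toList.count c = (Finset.univ.filter fun i : Fin x.toList.length =>
      x.toList[i] = c).card := by
    have := Fin.card_filter_univ_eq_vector_get_eq_count c (⟨x.toList, rfl⟩ : List.Vector Bool _)
    simpa [List.Vector.get, eq_comm] using this.symm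
  rw [h1, ← Set.ncard_coe_finset]
  refine Set.ncard_le_ncard_of_injOn (fun i => ofList (x.toList.rotate i)) ?_ ?_
    ((finite_conj x).subset fun y hy => hy.1)
  · intro i hi
    refine ⟨conj_iff_isRotated.2 ⟨i, rfl⟩, ofList (x.toList.drop (i + 1) ++ x.toList.take i), ?_⟩
    apply toList.injective
    rw [toList_ofList, List.rotate_eq_drop_append_take i.2.le, toList_of_mul, toList_ofList,
      List.drop_eq_getElem_cons i.2, List.cons_append]
    congr 1
    simpa using hi
  · intro i _ j _ h
    exact Fin.ext (hx.rotate_inj i.2 j.2 (ofList.injective h))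

theorem toList_of_pow {α : Type*} (c : α) (n : ℕ) : (of c ^ n).toList = List.replicate n c := by
  induction n with
  | zero => rfl
  | succ n ih => rw [pow_succ', toList_of_mul, ih, List.replicate_succ]

theorem eq_pow_of_notMem {x : FreeMonoid Bool} {c : Bool} (h : (!c) ∉ x.toList) :
    x = of c ^ x.length := by
  have h1 : x.toList = List.replicate x.length c := List.eq_replicate_of_mem fun d hd => by
    by_contra hne
    rw [← ne_eq, ← Bool.eq_not] at hne
    exact h (hne ▸ hd)
  exact toList.injective (by rw [toList_of_pow, ← h1])

/-- A primitive word whose image is shorter than the images of both letters together is a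
letter. -/
theorem IsPrimitive.eq_of {α : Type*} {μ : FreeMonoid Bool →* FreeMonoid α} {x : FreeMonoid Bool}
    (hx : IsPrimitive x)
    (h : (μ x).length < (μ (of false)).length + (μ (of true)).length) : ∃ c, x = of c := by
  rw [length_map_eq_sum] at h
  simp only [Fintype.sum_bool] at h
  have : ∃ c, (!c) ∉ x.toList := by
    by_contra hne
    push Not at hne
    have h1 := List.count_pos_iff.2 (hne false)
    have h2 := List.count_pos_iff.2 (hne true)
    simp only [Bool.not_false, Bool.not_true] at h1 h2
    have := Nat.le_mul_of_pos_left (μ (of false)).length h2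
    have := Nat.le_mul_of_pos_left (μ (of true)).length h1
    omega
  obtain ⟨c, hc⟩ := this
  exact ⟨c, hx.eq_of_eq_pow (eq_pow_of_notMem hc)⟩

theorem pow_mem_fac {α : Type*} {x y : FreeMonoid α} (h : Conj x y) (n : ℕ) : y ^ n ∈ Fac x :=
  Fac.conj h.symm ⟨n, 1, 1, by simp⟩

theorem pow_left_inj_word {α : Type*} {x y : FreeMonoid α} {n : ℕ} (hn : n ≠ 0)
    (h : x ^ n = y ^ n) : x = y := by
  obtain ⟨n, rfl⟩ := Nat.exists_eq_succ_of_ne_zero hn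
  have hl := congrArg FreeMonoid.length h
  rw [length_pow, length_pow] at hl
  rw [Nat.succ_eq_add_one, pow_succ', pow_succ'] at h
  exact (mul_eq_mul_of_length h (Nat.eq_of_mul_eq_mul_left n.succ_pos hl)).1

/-- For two non-conjugate primitive words over a binary alphabet, the factors of their powers that
start with `c` have many branching words: the powers of length `|x| |y|` of the rotations of `x` and
of `y` that start with `c` are pairwise different. -/
theorem count_add_count_le_branching {x y : FreeMonoid Bool} (hx : IsPrimitive x)
    (hy : IsPrimitive y) (hxy : ¬ Conj x y) (c : Bool) :
    ∃ R : Finset (FreeMonoid Bool), x.toList.count c + y.toList.count c ≤ 1 + R.card ∧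
      ∀ f ∈ R, ∀ d, of c * f * of d ∈ Fac x ∪ Fac y := by
  have hxl := length_pos_of_ne_one hx.1
  have hyl := length_pos_of_ne_one hy.1
  let T : Set (FreeMonoid Bool) := {f | of c * f ∈ Fac x ∪ Fac y}
  have hT : ∀ f d, f * of d ∈ T → f ∈ T := by
    rintro f d (h | h) <;> rw [← mul_assoc] at h
    · exact Or.inl (Fac.left h)
    · exact Or.inr (Fac.left h)
  have hb := ncard_le_branching T hT (x.length * y.length - 1)
  have hfin : {f | f.length < x.length * y.length - 1 ∧ f * of false ∈ T ∧ f * of true ∈ T}.Finite :=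
    (List.finite_length_le Bool (x.length * y.length - 1)).subset fun f hf => hf.1.le
  refine ⟨hfin.toFinset, ?_, ?_⟩
  · rw [← Set.ncard_eq_toFinset_card _ hfin]
    refine le_trans ?_ hb
    let A : Set (FreeMonoid Bool) := {z | Conj x z ∧ ∃ t, z = of c * t}
    let B : Set (FreeMonoid Bool) := {z | Conj y z ∧ ∃ t, z = of c * t}
    have hA : A.Finite := (finite_conj x).subset fun y hy => hy.1
    have hB : B.Finite := (finite_conj y).subset fun y hy => hy.1
    have hsub : (fun z => z ^ y.length) '' A ∪ (fun z => z ^ x.length) '' B ⊆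
        (fun f => of c * f) '' {f | f ∈ T ∧ f.length = x.length * y.length - 1} := by
      have key : ∀ (z : FreeMonoid Bool) (n : ℕ), n ≠ 0 → (∃ t, z = of c * t) →
          z ^ n ∈ Fac x ∪ Fac y → z.length * n = x.length * y.length →
          z ^ n ∈ (fun f => of c * f) '' {f | f ∈ T ∧ f.length = x.length * y.length - 1} := by
        rintro z n hn ⟨t, ht⟩ hz hl
        obtain ⟨n, rfl⟩ := Nat.exists_eq_succ_of_ne_zero hn
        have h1 : z ^ (n + 1) = of c * (t * z ^ n) := by
          rw [pow_succ', ← mul_assoc, ← ht]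
        refine ⟨t * z ^ n, ⟨?_, ?_⟩, h1.symm⟩
        · change of c * _ ∈ Fac x ∪ Fac y
          rw [← h1]; exact hz
        · have := congrArg FreeMonoid.length h1
          rw [length_pow, mul_comm, hl, length_mul (of c), length_of] at this
          omega
      rintro _ (⟨z, ⟨hz, ht⟩, rfl⟩ | ⟨z, ⟨hz, ht⟩, rfl⟩)
      · exact key z _ hyl.ne' ht (Or.inl (pow_mem_fac hz _)) (by rw [hz.length_eq])
      · exact key z _ hxl.ne' ht (Or.inr (pow_mem_fac hz _)) (by rw [hz.length_eq, mul_comm])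
    have h1 := Set.ncard_le_ncard hsub (((List.finite_length_le Bool
      (x.length * y.length - 1)).subset fun f hf => hf.2.le).image _)
    rw [Set.ncard_union_eq ?_ (hA.image _) (hB.image _),
      Set.InjOn.ncard_image fun f _ g _ h => pow_left_inj_word hyl.ne' h,
      Set.InjOn.ncard_image fun f _ g _ h => pow_left_inj_word hxl.ne' h,
      Set.InjOn.ncard_image fun f _ g _ h => mul_left_cancel h] at h1
    · exact (add_le_add (hx.count_le c) (hy.count_le c)).trans h1
    · rw [Set.disjoint_left]
      rintro _ ⟨z, hz, rfl⟩ ⟨z', hz', h⟩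
      have := (hz'.1.isPrimitive hy).eq_of_pow_eq_pow (hz.1.isPrimitive hx) hxl.ne' h
      exact hxy (hz.1.trans (this ▸ hz'.1.symm))
  · intro f hf d
    rw [Set.Finite.mem_toFinset] at hf
    have : f * of d ∈ T := by
      cases d
      · exact hf.2.1
      · exact hf.2.2
    rw [mul_assoc]
    exact this

theorem IsSplit.mem_fac {α : Type*} {μ : FreeMonoid Bool →* FreeMonoid α} {τ : FreeMonoid α}
    {E : Bool → α} (h : IsSplit μ τ E) (hμ : Noncomm μ) {x f : FreeMonoid Bool} {d : Bool}
    (hx : x ≠ 1) (hf : f * of d ∈ Fac x) : μ f * τ * of (E d) ∈ Fac (μ x) := by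
  obtain ⟨q, hq, hl⟩ := Fac.extend hx hf (τ.length + 1)
  rw [mul_assoc] at hq
  obtain ⟨r, hr⟩ := h.2 d q (by
    have := hμ.length_le (of d * q)
    rw [length_mul] at this
    omega)
  have := Fac.map hq μ
  rw [map_mul, hr, ← mul_assoc, ← mul_assoc] at this
  exact Fac.left this

/-- If the images of two non-conjugate primitive words under a binary morphism are conjugate, then
the two words are the two letters. The branching words of the two periodic words lift to branching
words of the periodic image, together with their suffixes that start inside the image of the first
letter; the image would have too many branching words if it were as long as the images of both
letters together. -/
theorem LastDiffer.letters_of_conj {α : Type*} {μ : FreeMonoid Bool →* FreeMonoid α}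
    (hμ : LastDiffer μ) {x y : FreeMonoid Bool} (hx : IsPrimitive x) (hy : IsPrimitive y)
    (hxy : ¬ Conj x y) (h : Conj (μ x) (μ y)) : ∃ c, x = of c ∧ y = of (!c) := by
  classical
  obtain ⟨τ, E, hE⟩ := hμ.noncomm.exists_isSplit
  choose R hR1 hR2 using count_add_count_le_branching hx hy hxy
  have hμx : μ x ≠ 1 := fun h' => hx.1 (hμ.injective (by simpa using h'))
  -- the branching words: `f` in the union of the two languages, preceded by a suffix of `μ (of c)`
  let suf : Bool → ℕ → FreeMonoid α := fun c j => ofList ((μ (of c)).toList.drop j)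
  have hsuf : ∀ c j, ∃ p, μ (of c) = p * suf c j := fun c j =>
    ⟨ofList ((μ (of c)).toList.take j), toList.injective (by simp [suf])⟩
  have hsl : ∀ c j, (suf c j).length = (μ (of c)).length - j := fun c j => by
    simp [suf, FreeMonoid.length]
  let F : (Σ _ : Bool, FreeMonoid Bool × ℕ) → FreeMonoid α := fun s =>
    suf s.1 s.2.2 * μ s.2.1 * τ
  let I : Finset (Σ _ : Bool, FreeMonoid Bool × ℕ) :=
    Finset.univ.sigma fun c => R c ×ˢ Finset.range (μ (of c)).length
  have hinj : Set.InjOn F I := by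
    rintro ⟨c, f, j⟩ hs ⟨d, g, k⟩ ht hst
    simp only [I, Finset.coe_sigma, Set.mem_sigma_iff, Finset.mem_coe, Finset.mem_product,
      Finset.mem_range] at hs ht
    obtain ⟨p, hp⟩ := hsuf c j
    obtain ⟨q, hq⟩ := hsuf d k
    have h1 := hsl c j
    have h2 := hsl d k
    obtain ⟨rfl, h3, rfl⟩ := hμ.parse_unique (fun h' => by simp [h'] at h1; omega)
      (fun h' => by simp [h'] at h2; omega) hp hq (mul_right_cancel hst)
    rw [h3] at h1
    obtain rfl : j = k := by omega
    rfl
  have hbr : ∀ f ∈ I.image F, ∃ c d, c ≠ d ∧ f * of c ∈ Fac (μ x) ∧ f * of d ∈ Fac (μ x) := by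
    intro f hf
    obtain ⟨⟨c, f, j⟩, hs, rfl⟩ := Finset.mem_image.1 hf
    simp only [I, Finset.mem_sigma, Finset.mem_product] at hs
    obtain ⟨p, hp⟩ := hsuf c j
    have key : ∀ d, F ⟨c, f, j⟩ * of (E d) ∈ Fac (μ x) := by
      intro d
      have h1 : μ (of c * f) * τ * of (E d) ∈ Fac (μ x) := by
        rcases hR2 c f hs.2.1 d with h' | h'
        · exact hE.mem_fac hμ.noncomm hx.1 h'
        · exact Fac.conj h.symm (hE.mem_fac hμ.noncomm hy.1 h')
      rw [map_mul, hp] at h1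
      simp only [mul_assoc] at h1
      simpa only [F, mul_assoc] using Fac.right h1
    exact ⟨E false, E true, hE.1, key false, key true⟩
  have hcard := Fac.branching_lt hμx _ hbr
  rw [Finset.card_image_of_injOn hinj, Finset.card_sigma] at hcard
  simp only [Finset.card_product, Finset.card_range, Fintype.sum_bool] at hcard
  have hlx := length_map_eq_sum μ x
  have hly := length_map_eq_sum μ y
  rw [← h.length_eq] at hly
  simp only [Fintype.sum_bool] at hlx hly
  have h0 := Nat.mul_le_mul_right (μ (of false)).length (hR1 false)
  have h1 := Nat.mul_le_mul_right (μ (of true)).length (hR1 true)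
  simp only [add_mul, one_mul] at h0 h1
  -- there are at least `2 |μ x| - |μ a| - |μ b|` branching words, but fewer than `|μ x|`
  have hlt : (μ x).length < (μ (of false)).length + (μ (of true)).length := by omega
  obtain ⟨c, rfl⟩ := hx.eq_of hlt
  obtain ⟨d, rfl⟩ := hy.eq_of (μ := μ) (by rwa [← h.length_eq])
  refine ⟨c, rfl, ?_⟩
  have : d ≠ c := by
    rintro rfl
    exact hxy (Conj.refl _)
  rw [Bool.eq_not.2 this]

/-! ### Two unsynchronized factorizations of the same word -/

theorem semiconj_pow {α : Type*} {A B e : FreeMonoid α} (h : A * e = e * B) (n : ℕ) :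
    A ^ n * e = e * B ^ n := by
  induction n with
  | zero => simp
  | succ n ih => rw [pow_succ', mul_assoc, ih, ← mul_assoc, h, mul_assoc, ← pow_succ']

theorem exists_mul_eq_pow_of_semiconj {α : Type*} {A B e : FreeMonoid α} (hA : A ≠ 1)
    (h : A * e = e * B) : ∃ t, A ^ e.length = e * t := by
  have h1 := semiconj_pow h e.length
  obtain ⟨t, ht, -⟩ := levi_left h1.symm (by
    have := length_pos_of_ne_one hA
    rw [length_pow]
    nlinarith)
  exact ⟨t, ht⟩

theorem conj_of_semiconj {α : Type*} (n : ℕ) {A B e : FreeMonoid α} (hn : e.length ≤ n)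
    (h : A * e = e * B) : Conj A B := by
  induction n generalizing e with
  | zero =>
    have he : e = 1 := length_eq_zero.1 (by omega)
    subst he
    simp only [mul_one, one_mul] at h
    exact h ▸ Conj.refl A
  | succ n ih =>
    rcases levi h with ⟨t, rfl, h2⟩ | ⟨t, rfl, h2⟩
    · by_cases hA : A = 1
      · subst hA
        have : B = 1 := by simpa using h
        rw [this]
        exact Conj.refl 1
      · refine ih (e := t) ?_ h2
        have := length_pos_of_ne_one hA
        rw [length_mul] at hn
        omega
    · exact ⟨e, t, rfl, h2⟩

/-- For a primitivity-preserving morphism whose images end with different letters, a factorization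
of a word can meet the same overhang `e` of a shifted factorization twice only if one factorization
repeats one letter and the other factorization repeats the other letter in between. -/
theorem LastDiffer.letters_of_overhang {α : Type*} {μ : FreeMonoid Bool →* FreeMonoid α}
    (hμ : LastDiffer μ) (hpp : PrimitivityPreserving μ) {x y : FreeMonoid Bool}
    {d : Bool} {p e : FreeMonoid α} (hx : x ≠ 1) (hy : y ≠ 1) (he : e ≠ 1) (hp : p ≠ 1)
    (hd : μ (of d) = p * e) (h : μ x * e = e * μ y) :
    ∃ c n m, n ≠ 0 ∧ m ≠ 0 ∧ x = of c ^ n ∧ y = of (!c) ^ m ∧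
      μ (of c) * e = e * μ (of (!c)) := by
  obtain ⟨x, i, hxp, hi, rfl⟩ := exists_primitive_root x hx
  obtain ⟨y, j, hyp, hj, rfl⟩ := exists_primitive_root y hy
  have hX := hpp x hxp
  have hY := hpp y hyp
  have hconj := conj_of_semiconj _ le_rfl h
  rw [map_pow, map_pow] at hconj
  obtain ⟨z, hz, hzi⟩ := hconj.exists_pow
  obtain rfl := hY.eq_of_pow_eq_pow (hz.isPrimitive hX) hj hzi
  obtain rfl : i = j := by
    have := congrArg FreeMonoid.length hzi
    rw [length_pow, length_pow] at this
    exact (Nat.eq_of_mul_eq_mul_right (length_pos_of_ne_one hY.1) this).symm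
  by_cases hxy : Conj x y
  · -- both factorizations follow the same periodic word, so `e` is an image
    exfalso
    obtain ⟨t, ht⟩ := exists_mul_eq_pow_of_semiconj
      (fun h' => hx (hμ.injective (by simpa using h'))) h
    obtain ⟨g, k, rfl, rfl⟩ := hxy
    obtain ⟨G, hG⟩ : ∃ G, G = ((g * k) ^ i) ^ e.length * g := ⟨_, rfl⟩
    have hmG : μ G = e * (t * μ g) := by
      rw [hG, map_mul, map_pow, ht, mul_assoc]
    have hGc : (g * k) ^ i * G = G * (k * g) ^ i := by
      rw [hG, mul_assoc, mul_pow_conj, ← mul_assoc, ← mul_assoc, ← pow_succ, ← pow_succ']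
    have h1 := congrArg μ hGc
    rw [map_mul, map_mul, hmG, ← mul_assoc, h, mul_assoc, mul_assoc] at h1
    have h2 := mul_left_cancel h1
    rw [map_pow] at h2
    obtain ⟨n, hn⟩ := hY.eq_of_commute (commute_of_commute_pow hi h2.symm).symm
    rw [hn, ← map_pow] at hmG
    have hG1 : G ≠ 1 := by
      intro h'
      rw [h', map_one] at hmG
      have := congrArg FreeMonoid.length hmG
      rw [length_mul, length_one] at this
      have := length_pos_of_ne_one he
      omega
    obtain ⟨c, G', hG'⟩ := exists_of_mul hG1
    rw [hG', map_mul] at hmG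
    obtain ⟨rfl, h3, -⟩ := hμ.parse_unique (c := c) (p := 1) (hμ.noncomm.ne_one c) he (by simp) hd hmG
    rw [h3] at hd
    exact hp (by simpa using hd)
  · -- the roots are the two letters, and the relation descends from powers to roots
    obtain ⟨c, rfl, rfl⟩ := hμ.letters_of_conj hxp hyp hxy hz
    have hlt : e.length ≤ (μ (of c)).length := by
      have h1 := hz.length_eq
      have h2 := congrArg FreeMonoid.length hd
      rw [length_mul] at h2
      cases c <;> cases d <;> simp only [Bool.not_true, Bool.not_false] at h1 <;> omega
    refine ⟨c, i, i, hi, hi, rfl, rfl, ?_⟩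
    rw [map_pow, map_pow] at h
    have h0 : μ (of c) * (μ (of c) ^ (i - 1) * e) = e * μ (of (!c)) ^ i := by
      rw [← mul_assoc, ← pow_succ', Nat.sub_add_cancel (Nat.pos_of_ne_zero hi), h]
    obtain ⟨t, ht, -⟩ := levi_left h0.symm hlt
    rw [ht, ← mul_pow_conj] at h
    have := pow_left_inj_word hi (mul_left_cancel h)
    rw [ht, ← this, mul_assoc]

/-! ### Runs of the Burrows–Wheeler transform as transitions between adjacent rotations -/

/-- The elements `x` of `S` that have a successor in `S` at which `g` takes a different value. -/
noncomputable def transitions {K β : Type*} [LinearOrder K] (g : K → β) (S : Finset K) : Finset K :=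
  open Classical in
  S.filter fun x => ∃ y ∈ S, x < y ∧ (∀ z ∈ S, x < z → y ≤ z) ∧ g x ≠ g y

theorem mem_transitions {K β : Type*} [LinearOrder K] {g : K → β} {S : Finset K} {x : K} :
    x ∈ transitions g S ↔
      x ∈ S ∧ ∃ y ∈ S, x < y ∧ (∀ z ∈ S, x < z → y ≤ z) ∧ g x ≠ g y := by
  classical
  simp [transitions]

theorem exists_rle_cons {α : Type*} [DecidableEq α] (d : α) (t : List α) :
    ∃ l s, rle (d :: t) = (d, l) :: s := by
  rw [rle]
  rcases h : rle t with _ | ⟨⟨e, l⟩, s⟩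
  · exact ⟨1, [], rfl⟩
  · by_cases hde : d = e
    · subst hde
      exact ⟨l + 1, s, by simp⟩
    · exact ⟨1, (e, l) :: s, by simp [hde]⟩

theorem length_rle_cons_cons {α : Type*} [DecidableEq α] (c d : α) (t : List α) :
    (rle (c :: d :: t)).length = (rle (d :: t)).length + if c = d then 0 else 1 := by
  obtain ⟨l, s, h⟩ := exists_rle_cons d t
  rw [rle, h]
  by_cases hcd : c = d <;> simp [hcd]

theorem length_rle_filterMap {K α : Type*} [LinearOrder K] [DecidableEq α] (g : K → Option α)
    (l : List K) (hl : l.Pairwise (· ≤ ·)) (hg : ∀ x ∈ l, (g x).isSome) (hne : l ≠ []) :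
    (rle (l.filterMap g)).length = 1 + (transitions g l.toFinset).card := by
  induction l with
  | nil => exact absurd rfl hne
  | cons x l ih =>
    obtain ⟨c, hc⟩ := Option.isSome_iff_exists.1 (hg x (by simp))
    rcases l with _ | ⟨y, l⟩
    · have : transitions g ([x] : List K).toFinset = ∅ := by
        ext z
        simp only [mem_transitions, List.toFinset_cons, List.toFinset_nil, insert_empty_eq,
          Finset.mem_singleton, Finset.notMem_empty, iff_false]
        rintro ⟨rfl, y, rfl, h, -⟩
        exact h.false
      rw [this]
      simp [hc, rle]
    · obtain ⟨d, hd⟩ := Option.isSome_iff_exists.1 (hg y (by simp))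
      have hl' := List.pairwise_cons.1 hl
      have hxy : x ≤ y := hl'.1 y (by simp)
      have hmin : ∀ z ∈ y :: l, y ≤ z := by
        intro z hz
        rcases List.mem_cons.1 hz with rfl | hz
        · exact le_rfl
        · exact (List.pairwise_cons.1 hl'.2).1 z hz
      have ih' := ih hl'.2 (fun z hz => hg z (List.mem_cons_of_mem _ hz)) (by simp)
      rw [List.filterMap_cons_some hc, List.filterMap_cons_some hd, length_rle_cons_cons,
        ← List.filterMap_cons_some hd, ih']
      rcases hxy.eq_or_lt with rfl | hlt
      · have hcd : c = d := Option.some_injective _ (hc.symm.trans hd)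
        rw [if_pos hcd]
        simp
      · have hx : x ∉ (y :: l).toFinset := by
          rw [List.mem_toFinset]
          intro h
          exact (hmin x h).not_gt hlt
        have htr : transitions g (x :: y :: l).toFinset =
            transitions g (y :: l).toFinset ∪ if c = d then ∅ else {x} := by
          ext z
          rw [Finset.mem_union, mem_transitions, mem_transitions, List.toFinset_cons (a := x)]
          constructor
          · rintro ⟨hz, w, hw, hzw, hmz, hgz⟩
            rcases Finset.mem_insert.1 hz with rfl | hz
            · right
              have hwy : w = y := by
                refine le_antisymm (hmz y (by simp) hlt) ?_
                rcases Finset.mem_insert.1 hw with rfl | hw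
                · exact absurd hzw (lt_irrefl _)
                · exact hmin w (List.mem_toFinset.1 hw)
              subst hwy
              rw [hc, hd] at hgz
              rw [if_neg (fun h => hgz (by rw [h]))]
              simp
            · left
              have hyz := hmin z (List.mem_toFinset.1 hz)
              rcases Finset.mem_insert.1 hw with rfl | hw
              · exact absurd (hyz.trans_lt hzw) hlt.not_gt
              · exact ⟨hz, w, hw, hzw, fun v hv => hmz v (Finset.mem_insert_of_mem hv), hgz⟩
          · rintro (⟨hz, w, hw, hzw, hmz, hgz⟩ | h)
            · refine ⟨Finset.mem_insert_of_mem hz, w, Finset.mem_insert_of_mem hw, hzw, ?_, hgz⟩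
              intro v hv hzv
              rcases Finset.mem_insert.1 hv with rfl | hv
              · have := hmin z (List.mem_toFinset.1 hz)
                exact absurd (this.trans_lt hzv) hlt.not_gt
              · exact hmz v hv hzv
            · by_cases hcd : c = d
              · simp [hcd] at h
              · rw [if_neg hcd, Finset.mem_singleton] at h
                subst h
                refine ⟨Finset.mem_insert_self _ _, y, by simp, hlt, ?_, ?_⟩
                · intro v hv hzv
                  rcases Finset.mem_insert.1 hv with rfl | hv
                  · exact absurd hzv (lt_irrefl _)
                  · exact hmin v (List.mem_toFinset.1 hv)
                · rw [hc, hd]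
                  exact fun h => hcd (Option.some_injective _ h)
        rw [htr]
        by_cases hcd : c = d
        · simp [hcd]
        · rw [if_neg hcd, if_neg hcd, Finset.card_union_of_disjoint, Finset.card_singleton,
            add_assoc]
          rw [Finset.disjoint_singleton_right, mem_transitions]
          exact fun h => hx h.1

/-- The set of rotations of a word. -/
def rots {α : Type*} [LinearOrder α] (w : FreeMonoid α) : Finset (List α) :=
  (rotations w).toFinset

theorem mem_rots {α : Type*} [LinearOrder α] {w : FreeMonoid α} (hw : w ≠ 1) {x : List α} :
    x ∈ rots w ↔ Conj w (ofList x) := by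
  have hpos : 0 < w.toList.length := length_pos_of_ne_one hw
  simp only [rots, rotations, Multiset.mem_toFinset, Multiset.mem_map, Multiset.mem_range,
    conj_iff_isRotated, toList_ofList]
  constructor
  · rintro ⟨i, -, rfl⟩
    exact ⟨i, rfl⟩
  · rintro ⟨i, rfl⟩
    exact ⟨i % w.toList.length, Nat.mod_lt _ hpos, List.rotate_mod _ _⟩

theorem r_eq {α : Type*} [LinearOrder α] {w : FreeMonoid α} (hw : w ≠ 1) :
    r w = 1 + (transitions List.getLast? (rots w)).card := by
  have h1 : ((rotations w).sort (· ≤ ·)).toFinset = rots w := by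
    ext x
    simp [rots]
  have hmem : ∀ x ∈ (rotations w).sort (· ≤ ·), x ∈ rots w := by
    intro x hx
    rwa [← h1, List.mem_toFinset]
  rw [r, bwt, toList_ofList, length_rle_filterMap _ _ (Multiset.pairwise_sort _ _)]
  · congr 3
    ext x
    simp [rots]
  · intro x hx
    have := ((mem_rots hw).1 (hmem x hx)).length_eq
    have hpos := length_pos_of_ne_one hw
    rw [this] at hpos
    have hx' : x ≠ [] := by
      rintro rfl
      exact absurd hpos (by simp)
    simp [List.getLast?_isSome, hx']
  · intro h
    have : w.toList ∈ rots w := (mem_rots hw).2 (Conj.refl w)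
    rw [← h1, h] at this
    simp at this

theorem Conj.r_eq {α : Type*} [LinearOrder α] {w w' : FreeMonoid α} (h : Conj w w') :
    r w = r w' := by
  by_cases hw : w = 1
  · subst hw
    have : w' = 1 := length_eq_zero.1 (by simpa using h.length_eq.symm)
    rw [this]
  · have hw' : w' ≠ 1 := by
      rintro rfl
      exact hw (length_eq_zero.1 (by simpa using h.length_eq))
    rw [BWT.r_eq hw, BWT.r_eq hw']
    have : rots w = rots w' := by
      ext x
      rw [mem_rots hw, mem_rots hw']
      exact ⟨fun h' => h.symm.trans h', fun h' => h.trans h'⟩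
    rw [this]

/-! ### Counting transitions -/

/-- Pairs of elements of `S` with different values of `g` that span non-overlapping intervals
require as many transitions. -/
theorem card_le_card_transitions {K β ι : Type*} [LinearOrder K] {g : K → β} {S : Finset K}
    (I : Finset ι) (p q : ι → K) (hp : ∀ i ∈ I, p i ∈ S) (hq : ∀ i ∈ I, q i ∈ S)
    (hlt : ∀ i ∈ I, p i < q i) (hg : ∀ i ∈ I, g (p i) ≠ g (q i))
    (hd : ∀ i ∈ I, ∀ j ∈ I, i ≠ j → q i ≤ p j ∨ q j ≤ p i) :
    I.card ≤ (transitions g S).card := by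
  classical
  have key : ∀ i ∈ I, ∃ x ∈ transitions g S, p i ≤ x ∧ x < q i := by
    intro i hi
    -- the last element below `q i` with the value of `p i`
    obtain ⟨x, hx, hmax⟩ := Finset.exists_maximal
      (s := (S.filter fun x => p i ≤ x ∧ x < q i ∧ g x = g (p i)))
      ⟨p i, Finset.mem_filter.2 ⟨hp i hi, le_rfl, hlt i hi, rfl⟩⟩
    rw [Finset.mem_filter] at hx
    obtain ⟨hxS, hpx, hxq, hgx⟩ := hx
    obtain ⟨y, hy, hmin⟩ := Finset.exists_minimal (s := S.filter fun y => x < y)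
      ⟨q i, Finset.mem_filter.2 ⟨hq i hi, hxq⟩⟩
    rw [Finset.mem_filter] at hy
    have hymin : ∀ z ∈ S, x < z → y ≤ z := by
      intro z hz hxz
      by_contra hlt'
      push Not at hlt'
      exact hlt'.not_ge (hmin (Finset.mem_filter.2 ⟨hz, hxz⟩) hlt'.le)
    refine ⟨x, mem_transitions.2 ⟨hxS, y, hy.1, hy.2, hymin, fun h => ?_⟩, hpx, hxq⟩
    have hyq : y ≤ q i := hymin _ (hq i hi) hxq
    rcases hyq.eq_or_lt with h' | h'
    · exact hg i hi (by rw [← h', ← h, hgx])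
    · have := hmax (Finset.mem_filter.2 ⟨hy.1, hpx.trans hy.2.le, h', by rw [← h, hgx]⟩) hy.2.le
      exact this.not_gt hy.2
  rcases I.eq_empty_or_nonempty with rfl | ⟨i₀, -⟩
  · simp
  have : Nonempty K := ⟨p i₀⟩
  choose! e he h1 h2 using key
  refine Finset.card_le_card_of_injOn e (fun i hi => he i hi) ?_
  intro i hi j hj hij
  by_contra hne
  rcases hd i hi j hj hne with h | h
  · have := (h2 i hi).trans_le (h.trans (h1 j hj))
    rw [hij] at this
    exact this.false
  · have := (h2 j hj).trans_le (h.trans (h1 i hi))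
    rw [hij] at this
    exact this.false

/-- A finite family of upper sets separates only few adjacent pairs. -/
theorem card_le_card_of_separated {K ι : Type*} [LinearOrder K] {S T : Finset K}
    (I : Finset ι) (U : ι → K → Prop) (hU : ∀ i, ∀ x ∈ S, ∀ y ∈ S, x ≤ y → U i x → U i y)
    (hT : ∀ x ∈ T, x ∈ S ∧ ∃ y ∈ S, (∀ z ∈ S, x < z → y ≤ z) ∧ ∃ i ∈ I, ¬ U i x ∧ U i y) :
    T.card ≤ I.card := by
  rcases T.eq_empty_or_nonempty with rfl | ⟨x₀, hx₀⟩
  · simp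
  obtain ⟨-, -, -, -, i₀, -⟩ := hT x₀ hx₀
  have : Nonempty ι := ⟨i₀⟩
  have : Nonempty K := ⟨x₀⟩
  choose! hS s hs hsucc e he h1 h2 using hT
  refine Finset.card_le_card_of_injOn e (fun x hx => he x hx) ?_
  intro x hx y hy hxy
  by_contra hne
  wlog hlt : x < y generalizing x y
  · exact this hy hx hxy.symm (Ne.symm hne) (lt_of_le_of_ne (not_lt.1 hlt) (Ne.symm hne))
  exact h1 y hy (hU _ _ (hs x hx) _ (hS y hy) (hsucc x hx y (hS y hy) hlt) (hxy ▸ h2 x hx))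

/-! ### Lexicographic order of words and of their images -/

theorem lt_of_mismatch {α : Type*} [LinearOrder α] {p x y : FreeMonoid α} {c d : α} (hcd : c < d)
    (hx : p * of c ∣ x) (hy : p * of d ∣ y) : x.toList < y.toList := by
  obtain ⟨s, rfl⟩ := hx
  obtain ⟨t, rfl⟩ := hy
  induction p using FreeMonoid.inductionOn' with
  | one =>
    rw [one_mul, one_mul, toList_of_mul, toList_of_mul]
    exact List.cons_lt_cons_iff.2 (Or.inl hcd)
  | of_mul e p ih =>
    rw [mul_assoc, mul_assoc, mul_assoc, mul_assoc, toList_of_mul, toList_of_mul]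
    rw [mul_assoc, mul_assoc] at ih
    exact List.cons_lt_cons_iff.2 (Or.inr ⟨rfl, ih⟩)

theorem mismatch_of_lt {α : Type*} [LinearOrder α] {x y : FreeMonoid α} (hl : x.length = y.length)
    (h : x.toList < y.toList) :
    ∃ p c d s t, c < d ∧ x = p * of c * s ∧ y = p * of d * t := by
  rcases prefix_or_mismatch x y with ⟨t, ht⟩ | ⟨t, ht⟩ | ⟨p, c, d, s, t, hcd, hx, hy⟩
  · have := congrArg FreeMonoid.length ht
    rw [length_mul] at this
    have h1 : t = 1 := length_eq_zero.1 (by omega)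
    rw [ht, h1, mul_one] at h
    exact absurd h (lt_irrefl _)
  · have := congrArg FreeMonoid.length ht
    rw [length_mul] at this
    have h1 : t = 1 := length_eq_zero.1 (by omega)
    rw [ht, h1, mul_one] at h
    exact absurd h (lt_irrefl _)
  · rcases lt_or_gt_of_ne hcd with h' | h'
    · exact ⟨p, c, d, s, t, h', hx, hy⟩
    · exact absurd h (lt_of_mismatch h' (hy ▸ Dvd.intro _ rfl) (hx ▸ Dvd.intro _ rfl)).not_gt

theorem pow_lt_pow_word {α : Type*} [LinearOrder α] {x y : FreeMonoid α}
    (hl : x.length = y.length) (h : x.toList < y.toList) {n : ℕ} (hn : n ≠ 0) :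
    (x ^ n).toList < (y ^ n).toList := by
  obtain ⟨p, c, d, s, t, hcd, hx, hy⟩ := mismatch_of_lt hl h
  exact lt_of_mismatch hcd ((hx ▸ Dvd.intro _ rfl : _ ∣ x).trans (dvd_pow_self x hn))
    ((hy ▸ Dvd.intro _ rfl : _ ∣ y).trans (dvd_pow_self y hn))

theorem pow_le_pow_word {α : Type*} [LinearOrder α] {x y : FreeMonoid α}
    (hl : x.length = y.length) (h : x.toList ≤ y.toList) (n : ℕ) :
    (x ^ n).toList ≤ (y ^ n).toList := by
  rcases h.eq_or_lt with h | h
  · rw [toList.injective h]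
  · rcases Nat.eq_zero_or_pos n with rfl | hn
    · simp
    · exact (pow_lt_pow_word hl h hn.ne').le

theorem lt_of_pow_lt_pow_word {α : Type*} [LinearOrder α] {x y : FreeMonoid α}
    (hl : x.length = y.length) {n : ℕ} (h : (x ^ n).toList < (y ^ n).toList) :
    x.toList < y.toList := by
  by_contra hle
  exact (pow_le_pow_word hl.symm (not_lt.1 hle) n).not_gt h

theorem IsSplit.dvd_map {α : Type*} {μ : FreeMonoid Bool →* FreeMonoid α} {τ : FreeMonoid α}
    {E : Bool → α} (h : IsSplit μ τ E) (hμ : Noncomm μ) {x : FreeMonoid Bool} (c : Bool)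
    (hl : τ.length ≤ x.length) : τ * of (E c) ∣ μ (of c * x) := by
  refine h.2 c x ?_
  have := hμ.length_le (of c * x)
  rw [length_mul, length_of] at this
  omega

theorem IsSplit.dvd_map_pow {α : Type*} {μ : FreeMonoid Bool →* FreeMonoid α} {τ : FreeMonoid α}
    {E : Bool → α} (h : IsSplit μ τ E) (hμ : Noncomm μ) {x f x' : FreeMonoid Bool} {c : Bool}
    (hx : x = f * of c * x') : μ f * τ * of (E c) ∣ μ x ^ (τ.length + 1) := by
  obtain ⟨r, hr⟩ := h.dvd_map hμ (x := x' * x ^ τ.length) c (by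
    rw [length_mul, length_pow]
    have : 0 < x.length := by
      rw [hx, length_mul, length_mul, length_of]; omega
    nlinarith)
  refine ⟨r, ?_⟩
  rw [pow_succ', ← map_pow, ← map_mul]
  nth_rw 1 [hx]
  rw [mul_assoc, mul_assoc, map_mul, hr]
  simp only [mul_assoc]

/-- A binary morphism whose letter images do not commute either preserves or reverses the
lexicographic order between words of equal length with images of equal length. -/
theorem IsSplit.map_lt_map {α : Type*} [LinearOrder α] {μ : FreeMonoid Bool →* FreeMonoid α}
    {τ : FreeMonoid α} {E : Bool → α} (h : IsSplit μ τ E) (hμ : Noncomm μ)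
    {x y : FreeMonoid Bool} (hl : x.length = y.length) (hl' : (μ x).length = (μ y).length)
    (hxy : x.toList < y.toList) :
    (E false < E true → (μ x).toList < (μ y).toList) ∧
      (E true < E false → (μ y).toList < (μ x).toList) := by
  obtain ⟨p, c, d, s, t, hcd, hx, hy⟩ := mismatch_of_lt hl hxy
  obtain ⟨rfl, rfl⟩ : c = false ∧ d = true := by
    cases c <;> cases d <;> first | exact ⟨rfl, rfl⟩ | exact absurd hcd (by decide)
  have h1 := h.dvd_map_pow hμ hx
  have h2 := h.dvd_map_pow hμ hy
  exact ⟨fun hE => lt_of_pow_lt_pow_word hl' (lt_of_mismatch hE h1 h2),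
    fun hE => lt_of_pow_lt_pow_word hl'.symm (lt_of_mismatch hE h2 h1)⟩

/-! ### Factorization of the rotations of an image -/

theorem exists_split_of_map {σ α : Type*} {μ : FreeMonoid σ →* FreeMonoid α}
    {w : FreeMonoid σ} {g h : FreeMonoid α} (hw : μ w = g * h) (hh : h ≠ 1) :
    ∃ w₁ c w₂ p s, w = w₁ * of c * w₂ ∧ μ (of c) = p * s ∧ s ≠ 1 ∧ g = μ w₁ * p ∧
      h = s * μ w₂ := by
  induction w using FreeMonoid.inductionOn' generalizing g with
  | one =>
    have := congrArg FreeMonoid.length hw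
    rw [map_one, length_one, length_mul] at this
    exact absurd (length_eq_zero.1 (by omega)) hh
  | of_mul c w ih =>
    rw [map_mul] at hw
    by_cases hl : g.length < (μ (of c)).length
    · obtain ⟨t, h1, h2⟩ := levi_left hw.symm hl.le
      refine ⟨1, c, w, g, t, by simp, h1, ?_, by simp, h2⟩
      rintro rfl
      rw [mul_one] at h1
      rw [h1] at hl
      exact hl.false
    · obtain ⟨t, h1, h2⟩ := levi_left hw (not_lt.1 hl)
      obtain ⟨w₁, d, w₂, p, s, h3, h4, h5, h6, h7⟩ := ih h2
      exact ⟨of c * w₁, d, w₂, p, s, by rw [h3]; simp only [mul_assoc], h4, h5,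
        by rw [h1, h6, map_mul, mul_assoc], h7⟩

/-- Every rotation of the image of `w` starts inside (or at the beginning of) the image of a letter
`c`, and continues with the image of a word `x` such that `c x` is a rotation of `w`. -/
theorem exists_parse_of_conj {σ α : Type*} {μ : FreeMonoid σ →* FreeMonoid α}
    (hμ : ∀ c, μ (of c) ≠ 1) {w : FreeMonoid σ} (hw : w ≠ 1) {z : FreeMonoid α} (h : Conj (μ w) z) :
    ∃ c x p s, z = s * μ x * p ∧ μ (of c) = p * s ∧ s ≠ 1 ∧ Conj w (of c * x) := by
  obtain ⟨g, h, hg, rfl⟩ := h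
  by_cases hh : h = 1
  · subst hh
    obtain ⟨c, x, rfl⟩ := exists_of_mul hw
    refine ⟨c, x, 1, μ (of c), ?_, by simp, hμ c, Conj.refl _⟩
    rw [mul_one] at hg
    rw [one_mul, mul_one, ← hg, map_mul]
  · obtain ⟨w₁, c, w₂, p, s, rfl, h1, h2, rfl, rfl⟩ := exists_split_of_map hg hh
    refine ⟨c, w₂ * w₁, p, s, ?_, h1, h2, ⟨w₁, of c * w₂, ?_, ?_⟩⟩ <;>
      simp only [mul_assoc, map_mul]

theorem parse_dvd_pow {α : Type*} {μ : FreeMonoid Bool →* FreeMonoid α} {c : Bool}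
    {x : FreeMonoid Bool} {p s : FreeMonoid α} (hc : μ (of c) = p * s) (K : ℕ) :
    s * μ ((x * of c) ^ K) ∣ (s * μ x * p) ^ (K + 1) := by
  refine ⟨μ x * p, ?_⟩
  have h1 : (s * μ x * p) ^ K * s = s * μ ((x * of c) ^ K) := by
    rw [mul_assoc, ← mul_pow_conj, map_pow, map_mul, hc, mul_assoc]
  rw [← h1, pow_succ]
  simp only [mul_assoc]

/-- If a factorization of a word into images of letters is cut at an arbitrary place, then the next
cut of the factorization is reached by completing the image of a letter. -/
theorem exists_overhang {α : Type*} {μ : FreeMonoid Bool →* FreeMonoid α}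
    {Y : FreeMonoid Bool} {d : Bool} {p s A B : FreeMonoid α} (hd : μ (of d) = p * s)
    (hA : A ≠ 1) (h : s * μ Y = A * B) :
    ∃ Y₁ Y₂ e, Y = Y₁ * Y₂ ∧ s * μ Y₁ = A * e ∧ ∃ d' p', p' ≠ 1 ∧ μ (of d') = p' * e := by
  induction Y using FreeMonoid.inductionOn' generalizing d p s A with
  | one =>
    refine ⟨1, 1, B, by simp, h, d, p * A, ?_, ?_⟩
    · intro h'
      have := congrArg FreeMonoid.length h'
      have := length_pos_of_ne_one hA
      simp only [length_mul, length_one] at *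
      omega
    · rw [map_one, mul_one] at h
      rw [hd, h, mul_assoc]
  | of_mul c Y ih =>
    by_cases hl : A.length ≤ s.length
    · obtain ⟨t, h1, h2⟩ := levi_left h.symm hl
      refine ⟨1, of c * Y, t, by simp, by rw [map_one, mul_one, h1], d, p * A, ?_, ?_⟩
      · intro h'
        have := congrArg FreeMonoid.length h'
        have := length_pos_of_ne_one hA
        simp only [length_mul, length_one] at *
        omega
      · rw [hd, h1, mul_assoc]
    · obtain ⟨t, h1, h2⟩ := levi_left h (not_le.1 hl).le
      rw [map_mul] at h2
      have ht : t ≠ 1 := by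
        rintro rfl
        rw [mul_one] at h1
        rw [h1] at hl
        exact hl le_rfl
      obtain ⟨Y₁, Y₂, e, h3, h4, h5⟩ := ih (d := c) (p := 1) (by simp) ht h2
      exact ⟨of c * Y₁, Y₂, e, by rw [h3, mul_assoc], by rw [map_mul, h4, h1, mul_assoc], h5⟩

theorem length_map_le {α : Type*} (μ : FreeMonoid Bool →* FreeMonoid α) (x : FreeMonoid Bool) :
    (μ x).length ≤ x.length * ((μ (of false)).length + (μ (of true)).length) := by
  induction x using FreeMonoid.inductionOn' with
  | one => simp
  | of_mul c x ih =>
    rw [map_mul, length_mul, length_mul, length_of, add_mul, one_mul]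
    refine add_le_add ?_ ih
    cases c <;> omega

theorem exists_first_other {x : FreeMonoid Bool} (c : Bool) (h : (!c) ∈ x.toList) :
    ∃ k t, x = of c ^ k * of (!c) * t := by
  induction x using FreeMonoid.inductionOn' with
  | one => simp at h
  | of_mul d x ih =>
    by_cases hd : d = c
    · subst hd
      obtain ⟨k, t, hk⟩ := ih (by simpa using h)
      exact ⟨k + 1, t, by rw [hk, pow_succ']; simp only [mul_assoc]⟩
    · rw [← ne_eq, ← Bool.eq_not] at hd
      subst hd
      exact ⟨0, x, by simp⟩

/-- If `v` contains the letter other than `c`, then a word with arbitrarily long prefixes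
`A · μ (Z · v ^ K)` has a prefix in which the image of a power of `c` is followed by a deviation
from the images of longer powers of `c`. -/
theorem IsSplit.exists_deviation {α : Type*} {μ : FreeMonoid Bool →* FreeMonoid α}
    {τ : FreeMonoid α} {E : Bool → α} (h : IsSplit μ τ E) (hμ : Noncomm μ) {c : Bool}
    {Z v : FreeMonoid Bool} (hv : (!c) ∈ v.toList) {A z : FreeMonoid α} {m : ℕ}
    (hz : ∀ K, A * μ (Z * v ^ K) ∣ z ^ (K + m)) :
    ∃ k N, ∀ M, N ≤ M → A * μ (of c) ^ k * τ * of (E (!c)) ∣ z ^ M := by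
  obtain ⟨k, t, hk⟩ := exists_first_other (x := Z * v) c
    (by rw [toList_mul]; exact List.mem_append_right _ hv)
  have hvl : 0 < v.length := List.length_pos_of_mem hv
  refine ⟨k, 1 + τ.length + m, fun M hM => ?_⟩
  refine Dvd.dvd.trans ?_ ((hz (1 + τ.length)).trans (pow_dvd_pow z hM))
  have hZ : Z * v ^ (1 + τ.length) = of c ^ k * (of (!c) * (t * v ^ τ.length)) := by
    rw [pow_add, pow_one, ← mul_assoc, hk]
    simp only [mul_assoc]
  obtain ⟨r, hr⟩ := h.dvd_map hμ (x := t * v ^ τ.length) (!c) (by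
    rw [length_mul, length_pow]; nlinarith)
  rw [hZ, map_mul, map_pow, hr]
  exact ⟨r, by simp only [mul_assoc]⟩

theorem IsSplit.dvd_pow {α : Type*} {μ : FreeMonoid Bool →* FreeMonoid α}
    {τ : FreeMonoid α} {E : Bool → α} (h : IsSplit μ τ E) (hμ : Noncomm μ) (c : Bool)
    (A : FreeMonoid α) (k : ℕ) {M : ℕ} (hM : k + (1 + τ.length) ≤ M) :
    A * μ (of c) ^ k * τ * of (E c) ∣ A * μ (of c) ^ M := by
  obtain ⟨n, rfl⟩ := Nat.exists_eq_add_of_le hM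
  obtain ⟨r, hr⟩ := h.dvd_map hμ (x := of c ^ τ.length) c (by
    rw [length_pow, length_of, mul_one])
  refine ⟨r * μ (of c) ^ n, ?_⟩
  rw [pow_add, pow_add, pow_add, pow_one, ← map_pow _ _ τ.length, ← map_mul, hr]
  simp only [mul_assoc]

/-! ### Adjacent rotations of the image of a word -/

theorem dvd_of_dvd_of_length {α : Type*} {a b z : FreeMonoid α} (ha : a ∣ z) (hb : b ∣ z)
    (h : a.length ≤ b.length) : a ∣ b := by
  obtain ⟨s, rfl⟩ := ha
  obtain ⟨t, ht⟩ := hb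
  obtain ⟨r, hr, -⟩ := levi_left ht h
  exact ⟨r, hr⟩

theorem Conj.mem_iff {α : Type*} {x y : FreeMonoid α} (h : Conj x y) (c : α) :
    c ∈ x.toList ↔ c ∈ y.toList := by
  obtain ⟨g, h, rfl, rfl⟩ := h
  simp [or_comm]

theorem mem_of_mem_pow {α : Type*} {x : FreeMonoid α} {c : α} (n : ℕ)
    (h : c ∈ (x ^ n).toList) : c ∈ x.toList := by
  induction n with
  | zero => simp at h
  | succ n ih =>
    rw [pow_succ, toList_mul, List.mem_append] at h
    exact h.elim ih id

/-- Two rotations of images that share a long prefix either start at the same depth `p` inside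
the image of a letter, or they follow, after a prefix `Q` of bounded length, the powers of the images of
the two letters, shifted by an overhang `e`. -/
theorem LastDiffer.sync_or_overhang {Γ : Type*} [Finite Γ] {μ : FreeMonoid Bool →* FreeMonoid Γ}
    (hμ : LastDiffer μ) (hpp : PrimitivityPreserving μ) :
    ∃ L : ℕ, ∀ (c d : Bool) (x y : FreeMonoid Bool) (p s p' s' P : FreeMonoid Γ),
      μ (of c) = p * s → μ (of d) = p' * s' → s ≠ 1 → s' ≠ 1 → P.length = L →
      P ∣ (s * μ x * p) ^ L → P ∣ (s' * μ y * p') ^ L →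
      p = p' ∨ ∃ (Q e : FreeMonoid Γ) (a : Bool) (X Y : FreeMonoid Bool) (m : ℕ),
        Q.length ≤ L ∧ μ (of a) * e = e * μ (of (!a)) ∧
        a ∈ (x * of c).toList ∧ (!a) ∈ (y * of d).toList ∧
        (∀ K, Q * μ (X * (x * of c) ^ K) ∣ (s * μ x * p) ^ (K + m)) ∧
        (∀ K, Q * e * μ (Y * (y * of d) ^ K) ∣ (s' * μ y * p') ^ (K + m)) := by
  classical
  set l := (μ (of false)).length + (μ (of true)).length with hl
  have hl1 : 0 < l := by
    have := length_pos_of_ne_one (hμ.noncomm.ne_one false)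
    omega
  have hletter : ∀ c, (μ (of c)).length ≤ l := by
    intro c
    cases c <;> omega
  -- the overhangs are suffixes of images of letters: there are finitely many
  let 𝓔 : Finset (FreeMonoid Γ) := (List.finite_length_le Γ l).toFinset
  set D := 𝓔.card with hD
  refine ⟨(D + 1) * l, fun c d x y p s p' s' P hc hd hs hs' hP hPx hPy => ?_⟩
  set L := (D + 1) * l with hL
  have hDL : D ≤ L := by nlinarith
  have hlong : ∀ (x : FreeMonoid Bool) (c : Bool) (s : FreeMonoid Γ),
      L ≤ (s * μ ((x * of c) ^ L)).length := by
    intro x c s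
    have := hμ.noncomm.length_le ((x * of c) ^ L)
    rw [length_pow, length_mul, length_of] at this
    rw [length_mul]
    nlinarith
  have hPX : P ∣ s * μ ((x * of c) ^ L) := dvd_of_dvd_of_length
    (hPx.trans (pow_dvd_pow _ L.le_succ)) (parse_dvd_pow hc L) (hP ▸ hlong x c s)
  have hPY : P ∣ s' * μ ((y * of d) ^ L) := dvd_of_dvd_of_length
    (hPy.trans (pow_dvd_pow _ L.le_succ)) (parse_dvd_pow hd L) (hP ▸ hlong y d s')
  set X := (x * of c) ^ L with hX
  set Y := (y * of d) ^ L with hY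
  let Xt : ℕ → FreeMonoid Bool := fun i => ofList (X.toList.take i)
  let Xd : ℕ → FreeMonoid Bool := fun i => ofList (X.toList.drop i)
  have hXtd : ∀ i, X = Xt i * Xd i := fun i => toList.injective (by simp [Xt, Xd])
  have hXl : L ≤ X.length := by
    rw [hX, length_pow, length_mul, length_of]
    nlinarith
  have hXt : ∀ i ≤ D, (Xt i).length = i := fun i hi => by
    have : i ≤ X.toList.length := hi.trans (hDL.trans hXl)
    simp only [Xt, FreeMonoid.length, toList_ofList, List.length_take]
    omega
  have hAl : ∀ i ≤ D, (s * μ (Xt i)).length ≤ L := by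
    intro i hi
    have h1 := length_map_le μ (Xt i)
    rw [hXt i hi, ← hl] at h1
    have h2 : s.length ≤ l := by
      have := congrArg FreeMonoid.length hc
      have := hletter c
      rw [length_mul] at *
      omega
    rw [length_mul, hL]
    nlinarith
  have hov : ∀ i, ∃ Y₁ Y₂ e, i ≤ D → Y = Y₁ * Y₂ ∧ s' * μ Y₁ = s * μ (Xt i) * e ∧
      ∃ d' p', p' ≠ 1 ∧ μ (of d') = p' * e := by
    intro i
    by_cases hi : i ≤ D
    · have h1 : s * μ (Xt i) ∣ P := dvd_of_dvd_of_length (z := s * μ X)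
        (by rw [hXtd i, map_mul, ← mul_assoc]; exact Dvd.intro _ rfl) hPX (hP ▸ hAl i hi)
      obtain ⟨B, hB⟩ := h1.trans hPY
      obtain ⟨Y₁, Y₂, e, h⟩ := exists_overhang hd (fun h => hs (length_eq_zero.1 (by
        have := congrArg FreeMonoid.length h
        rw [length_mul, length_one] at this
        omega))) hB
      exact ⟨Y₁, Y₂, e, fun _ => h⟩
    · exact ⟨1, 1, 1, fun h => absurd h hi⟩
  choose Y₁ Y₂ e he using hov
  by_cases hsync : ∃ i ≤ D, e i = 1
  · left
    obtain ⟨i, hi, hei⟩ := hsync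
    have h1 := (he i hi).2.1
    rw [hei, mul_one] at h1
    obtain ⟨rfl, rfl, -⟩ := hμ.parse_unique hs' hs hd hc h1
    exact mul_right_cancel (hc.symm.trans hd)
  · right
    push Not at hsync
    -- the same overhang occurs twice, and the words read in between commute past it
    obtain ⟨i, hi, j, hj, hne, hij⟩ := Finset.exists_ne_map_eq_of_card_lt_of_maps_to
      (s := Finset.range (D + 1)) (t := 𝓔) (f := e) (by simp [hD]) (by
        intro i hi
        obtain ⟨d', p'', -, h⟩ := (he i (Nat.lt_succ_iff.1 (Finset.mem_range.1 hi))).2.2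
        have h1 := congrArg FreeMonoid.length h
        have h2 := hletter d'
        rw [length_mul] at h1
        exact Finset.mem_coe.2 ((Set.Finite.mem_toFinset _).2
          (show (e i).length ≤ l by omega)))
    wlog hlt : i < j generalizing i j
    · exact this j hj i hi hne.symm hij.symm (by omega)
    rw [Finset.mem_range, Nat.lt_succ_iff] at hi hj
    obtain ⟨hYi, hei, d', q, hq, hdq⟩ := he i hi
    obtain ⟨hYj, hej, -⟩ := he j hj
    rw [← hij] at hej
    obtain ⟨x₁, hx₁, hx₁'⟩ := levi_left ((hXtd i).symm.trans (hXtd j))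
      (by rw [hXt i hi, hXt j hj]; omega)
    have hx1 : x₁ ≠ 1 := by
      rintro rfl
      have := congrArg FreeMonoid.length hx₁
      rw [mul_one, hXt i hi, hXt j hj] at this
      omega
    have hpos := hμ.noncomm.length_le x₁
    have hpos' := length_pos_of_ne_one hx1
    rw [hx₁, map_mul] at hej
    have hlij : (μ (Y₁ j)).length = (μ (Y₁ i)).length + (μ x₁).length := by
      have h1 := congrArg FreeMonoid.length hei
      have h2 := congrArg FreeMonoid.length hej
      simp only [length_mul] at h1 h2
      omega
    obtain ⟨y₁, hy₁, hy₁'⟩ : ∃ t, Y₁ j = Y₁ i * t ∧ Y₂ i = t * Y₂ j := by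
      rcases levi (hYi.symm.trans hYj) with h | ⟨t, h1, -⟩
      · exact h
      · rw [h1, map_mul, length_mul] at hlij
        omega
    have hy1 : y₁ ≠ 1 := by
      rintro rfl
      rw [hy₁, mul_one] at hlij
      omega
    have hloop : μ x₁ * e i = e i * μ y₁ := by
      rw [hy₁, map_mul, ← mul_assoc, hei] at hej
      simp only [mul_assoc] at hej
      exact (mul_left_cancel (mul_left_cancel hej)).symm
    obtain ⟨a, n, m, hn, hm, hxa, hya, hae⟩ := hμ.letters_of_overhang hpp hx1 hy1
      (hsync i hi) hq hdq hloop
    have hmem : ∀ (b : Bool) (n : ℕ), n ≠ 0 → b ∈ (of b ^ n).toList := by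
      intro b n hn
      obtain ⟨n, rfl⟩ := Nat.exists_eq_succ_of_ne_zero hn
      rw [pow_succ', toList_of_mul]
      exact List.mem_cons_self
    refine ⟨s * μ (Xt i), e i, a, Xd i, Y₂ i, L + 1, hAl i hi, hae, ?_, ?_, ?_, ?_⟩
    · refine mem_of_mem_pow L ?_
      rw [← hX, hXtd j, hx₁, hxa]
      simp only [toList_mul, List.mem_append]
      exact Or.inl (Or.inr (hmem a n hn))
    · refine mem_of_mem_pow L ?_
      rw [← hY, hYj, hy₁, hya]
      simp only [toList_mul, List.mem_append]
      exact Or.inl (Or.inr (hmem (!a) m hm))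
    · intro K
      have := parse_dvd_pow (x := x) hc (L + K)
      rw [pow_add, ← hX, hXtd i, mul_assoc, map_mul, ← mul_assoc] at this
      rwa [show K + (L + 1) = L + K + 1 by ring]
    · intro K
      have := parse_dvd_pow (x := y) hd (L + K)
      rw [pow_add, ← hY, hYi, mul_assoc, map_mul, ← mul_assoc, hei] at this
      rwa [show K + (L + 1) = L + K + 1 by ring]

/-- The rotations that are eventually above the word `Q · μ(c) · μ(c) ⋯`. -/
def Above {Γ : Type*} [LinearOrder Γ] (μ : FreeMonoid Bool →* FreeMonoid Γ)
    (i : FreeMonoid Γ × Bool) (z : List Γ) : Prop :=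
  ∃ N, ∀ M, N ≤ M → (i.1 * μ (of i.2) ^ M).toList ≤ (ofList z ^ M).toList

/-- Two rotations that follow the powers of the images of the two letters lie on different sides of
the periodic word on which both deviate in opposite directions. -/
theorem not_above_and_above {Γ : Type*} [LinearOrder Γ] {μ : FreeMonoid Bool →* FreeMonoid Γ}
    (hμ : Noncomm μ) {z z' Q e : FreeMonoid Γ} {a : Bool} {X Y v v' : FreeMonoid Bool} {m : ℕ}
    (hz : z.length = z'.length) (hlt : z.toList < z'.toList)
    (hae : μ (of a) * e = e * μ (of (!a))) (hv : (!a) ∈ v.toList) (hv' : a ∈ v'.toList)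
    (h1 : ∀ K, Q * μ (X * v ^ K) ∣ z ^ (K + m))
    (h2 : ∀ K, Q * e * μ (Y * v' ^ K) ∣ z' ^ (K + m)) :
    ¬ Above μ (Q, a) z.toList ∧ Above μ (Q, a) z'.toList := by
  obtain ⟨τ, E, hE⟩ := hμ.exists_isSplit
  obtain ⟨k, N, hN⟩ := hE.exists_deviation hμ hv h1
  obtain ⟨k', N', hN'⟩ := hE.exists_deviation hμ (c := !a) (by rwa [Bool.not_not]) h2
  rw [Bool.not_not] at hN'
  have hπ : ∀ M, k + (1 + τ.length) ≤ M →
      Q * μ (of a) ^ k * τ * of (E a) ∣ Q * μ (of a) ^ M := fun M hM => hE.dvd_pow hμ a Q k hM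
  -- the same periodic word, read along the other factorization
  have hπ' : ∀ M, (Q * e * μ (of (!a)) ^ k' * τ * of (E (!a))).length + k' + (1 + τ.length) ≤ M →
      Q * e * μ (of (!a)) ^ k' * τ * of (E (!a)) ∣ Q * μ (of a) ^ M := by
    intro M hM
    refine dvd_of_dvd_of_length (hE.dvd_pow hμ (!a) (Q * e) k' (M := M) (by omega))
      ⟨e, ?_⟩ ?_
    · rw [mul_assoc, ← semiconj_pow hae, mul_assoc]
    · rw [length_mul Q (μ (of a) ^ M), length_pow]
      have := length_pos_of_ne_one (hμ.ne_one a)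
      nlinarith
  obtain ⟨B, hB⟩ : ∃ B, B = (Q * e * μ (of (!a)) ^ k' * τ * of (E (!a))).length := ⟨_, rfl⟩
  rw [← hB] at hπ'
  have hne : E a ≠ E (!a) := ne_of_bool_ne hE.1 (by simp)
  rcases lt_or_gt_of_ne hne with h | h
  · exfalso
    obtain ⟨M, hM⟩ : ∃ M, M = 1 + N + N' + k + k' + (1 + τ.length) + B := ⟨_, rfl⟩
    have h3 := lt_of_mismatch h (hπ M (by omega)) (hN M (by omega))
    have h4 := lt_of_mismatch h (hN' M (by omega)) (hπ' M (by omega))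
    exact (pow_lt_pow_word hz hlt (n := M) (by omega)).not_gt (h4.trans h3)
  · refine ⟨?_, N' + B + k' + (1 + τ.length), fun M hM => ?_⟩
    · rintro ⟨N₀, hN₀⟩
      have h3 := lt_of_mismatch h (hN (N + N₀ + k + (1 + τ.length)) (by omega))
        (hπ (N + N₀ + k + (1 + τ.length)) (by omega))
      exact (hN₀ (N + N₀ + k + (1 + τ.length)) (by omega)).not_gt h3
    · exact (lt_of_mismatch h (hπ' M (by omega)) (hN' M (by omega))).le

/-! ### Primitivity-preserving morphisms add boundedly many runs -/

theorem rots_length {α : Type*} [LinearOrder α] {w : FreeMonoid α} (hw : w ≠ 1) {x : List α}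
    (hx : x ∈ rots w) : (ofList x).length = w.length :=
  ((mem_rots hw).1 hx).length_eq.symm

theorem getLast?_mul {α : Type*} (p : FreeMonoid α) {s : FreeMonoid α} (hs : s ≠ 1) :
    (p * s).toList.getLast? = s.toList.getLast? := by
  obtain ⟨t, c, rfl⟩ := exists_mul_of hs
  rw [← mul_assoc]
  simp

theorem LastDiffer.getLast?_map_eq {α : Type*} {μ : FreeMonoid Bool →* FreeMonoid α}
    (hμ : LastDiffer μ) {x y : FreeMonoid Bool} (hx : x ≠ 1) (hy : y ≠ 1) :
    (μ x).toList.getLast? = (μ y).toList.getLast? ↔ x.toList.getLast? = y.toList.getLast? := by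
  obtain ⟨E, hE, hg⟩ := hμ
  obtain ⟨x, c, rfl⟩ := exists_mul_of hx
  obtain ⟨y, d, rfl⟩ := exists_mul_of hy
  obtain ⟨g, hg1⟩ := hg c
  obtain ⟨g', hg2⟩ := hg d
  rw [map_mul μ, map_mul μ, hg1, hg2, ← mul_assoc, ← mul_assoc]
  simp only [toList_mul, toList_of, List.getLast?_append, List.getLast?_singleton,
    Option.some_or, Option.some_inj]
  constructor
  · intro h
    by_contra hne
    exact ne_of_bool_ne hE hne h
  · rintro rfl
    rfl

/-- The transitions of the image of `w` between rotations starting at the beginning of images of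
letters are no more than the transitions of `w`; all the others are separated by finitely many words
and periodic words that depend on the morphism only. -/
theorem LastDiffer.exists_r_le {Γ : Type*} [Finite Γ] [LinearOrder Γ]
    {μ : FreeMonoid Bool →* FreeMonoid Γ} (hμ : LastDiffer μ) (hpp : PrimitivityPreserving μ) :
    ∃ K, ∀ w, w ≠ 1 → r (μ w) ≤ r w + K := by
  classical
  obtain ⟨L, hL⟩ := hμ.sync_or_overhang hpp
  obtain ⟨τ, E, hE⟩ := hμ.noncomm.exists_isSplit
  let I₁ : Finset (FreeMonoid Γ) := (List.finite_length_le Γ L).toFinset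
  have hI₁ : ∀ q : FreeMonoid Γ, q.length ≤ L → q ∈ I₁ := fun q hq =>
    (Set.Finite.mem_toFinset _).2 hq
  refine ⟨(I₁.disjSum (I₁ ×ˢ (Finset.univ : Finset Bool))).card, fun w hw => ?_⟩
  have hμw : μ w ≠ 1 := fun h => hw (hμ.injective (by rw [h, map_one]))
  rw [r_eq hμw, r_eq hw, add_assoc]
  refine Nat.add_le_add_left ?_ 1
  set S := rots (μ w) with hS
  set T := transitions List.getLast? S with hT
  -- the transitions at which both rotations start at the beginning of the image of a letter
  let T₁ : Finset (List Γ) := T.filter fun z => ∃ z' ∈ S, z < z' ∧ (∀ v ∈ S, z < v → z' ≤ v) ∧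
    z.getLast? ≠ z'.getLast? ∧ ∃ x ∈ rots w, ∃ y ∈ rots w,
      z = (μ (ofList x)).toList ∧ z' = (μ (ofList y)).toList
  have hsplit : T.card ≤ T₁.card + (T \ T₁).card := by
    rw [add_comm, Finset.card_sdiff_add_card_eq_card (Finset.filter_subset _ _)]
  refine hsplit.trans (add_le_add ?_ ?_)
  · -- these transitions come from transitions of `w`
    have hT₁ : ∀ z ∈ T₁, ∃ z' ∈ S, z < z' ∧ (∀ v ∈ S, z < v → z' ≤ v) ∧
        z.getLast? ≠ z'.getLast? ∧ ∃ x ∈ rots w, ∃ y ∈ rots w,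
          z = (μ (ofList x)).toList ∧ z' = (μ (ofList y)).toList :=
      fun z hz => (Finset.mem_filter.1 hz).2
    choose! s hsS hzs hsmin hsl x hx y hy hzx hsy using hT₁
    have hlen : ∀ u ∈ rots w, (ofList u).length = w.length ∧ ofList u ≠ 1 ∧
        (μ (ofList u)).length = (μ w).length := fun u hu =>
      ⟨rots_length hw hu, fun h => hw (length_eq_zero.1 (by rw [← rots_length hw hu, h, length_one])),
        (((mem_rots hw).1 hu).map μ).length_eq.symm⟩
    have hlast : ∀ z ∈ T₁, (x z).getLast? ≠ (y z).getLast? := by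
      intro z hz h
      refine hsl z hz ?_
      have := (hμ.getLast?_map_eq (hlen _ (hx z hz)).2.1 (hlen _ (hy z hz)).2.1).2 h
      rwa [← hzx z hz, ← hsy z hz] at this
    have hxne : ∀ z ∈ T₁, x z ≠ y z := fun z hz h => hlast z hz (by rw [h])
    have hmono : ∀ u ∈ rots w, ∀ v ∈ rots w, u < v →
        (E false < E true → (μ (ofList u)).toList < (μ (ofList v)).toList) ∧
        (E true < E false → (μ (ofList v)).toList < (μ (ofList u)).toList) := fun u hu v hv huv =>
      hE.map_lt_map hμ.noncomm ((hlen u hu).1.trans (hlen v hv).1.symm)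
        ((hlen u hu).2.2.trans (hlen v hv).2.2.symm) huv
    have hdisj : ∀ z ∈ T₁, ∀ z' ∈ T₁, z ≠ z' → s z ≤ z' ∨ s z' ≤ z := by
      intro z hz z' hz' hne
      have hzS : z ∈ S := (mem_transitions.1 (Finset.mem_filter.1 hz).1).1
      have hzS' : z' ∈ S := (mem_transitions.1 (Finset.mem_filter.1 hz').1).1
      rcases lt_or_gt_of_ne hne with h | h
      · exact Or.inl (hsmin z hz z' hzS' h)
      · exact Or.inr (hsmin z' hz' z hzS h)
    rcases lt_or_gt_of_ne hE.1 with hlt | hlt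
    · have hle : ∀ u ∈ rots w, ∀ v ∈ rots w,
          (μ (ofList u)).toList ≤ (μ (ofList v)).toList → u ≤ v := by
        intro u hu v hv h
        by_contra hc
        exact ((hmono v hv u hu (not_le.1 hc)).1 hlt).not_ge h
      refine card_le_card_transitions T₁ x y hx hy (fun z hz => ?_) hlast ?_
      · refine lt_of_le_of_ne (hle _ (hx z hz) _ (hy z hz) ?_) (hxne z hz)
        rw [← hzx z hz, ← hsy z hz]
        exact (hzs z hz).le
      · intro z hz z' hz' hne
        rcases hdisj z hz z' hz' hne with h | h
        · left
          rw [hzx z' hz', hsy z hz] at h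
          exact hle _ (hy z hz) _ (hx z' hz') h
        · right
          rw [hzx z hz, hsy z' hz'] at h
          exact hle _ (hy z' hz') _ (hx z hz) h
    · have hle : ∀ u ∈ rots w, ∀ v ∈ rots w,
          (μ (ofList u)).toList ≤ (μ (ofList v)).toList → v ≤ u := by
        intro u hu v hv h
        by_contra hc
        exact ((hmono u hu v hv (not_le.1 hc)).2 hlt).not_ge h
      refine card_le_card_transitions T₁ y x hy hx (fun z hz => ?_) (fun z hz => (hlast z hz).symm) ?_
      · refine lt_of_le_of_ne (hle _ (hx z hz) _ (hy z hz) ?_) (hxne z hz).symm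
        rw [← hzx z hz, ← hsy z hz]
        exact (hzs z hz).le
      · intro z hz z' hz' hne
        rcases hdisj z hz z' hz' hne with h | h
        · right
          rw [hzx z' hz', hsy z hz] at h
          exact hle _ (hy z hz) _ (hx z' hz') h
        · left
          rw [hzx z hz, hsy z' hz'] at h
          exact hle _ (hy z' hz') _ (hx z hz) h
  · -- the other adjacent pairs are separated by short words or by periodic words
    let U : FreeMonoid Γ ⊕ (FreeMonoid Γ × Bool) → List Γ → Prop := fun i z =>
      i.elim (fun q => q.toList ≤ (ofList z ^ L).toList) (fun q => Above μ q z)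
    refine card_le_card_of_separated (S := S) _ U ?_ ?_
    · intro i z hz z' hz' hzz' h
      have hl : (ofList z).length = (ofList z').length :=
        (rots_length hμw hz).trans (rots_length hμw hz').symm
      rcases i with q | q
      · exact le_trans h (pow_le_pow_word hl hzz' L)
      · obtain ⟨N, hN⟩ := h
        exact ⟨N, fun M hM => (hN M hM).trans (pow_le_pow_word hl hzz' M)⟩
    · intro z hz
      rw [Finset.mem_sdiff] at hz
      obtain ⟨hzT, hzT₁⟩ := hz
      obtain ⟨hzS, z', hz'S, hlt, hmin, hlast⟩ := mem_transitions.1 hzT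
      refine ⟨hzS, z', hz'S, hmin, ?_⟩
      have hl : (ofList z).length = (ofList z').length :=
        (rots_length hμw hzS).trans (rots_length hμw hz'S).symm
      have hzl : 0 < (ofList z).length := by
        rw [rots_length hμw hzS]
        exact length_pos_of_ne_one hμw
      obtain ⟨P, B, hPB, hP⟩ : ∃ P B, ofList z ^ L = P * B ∧ P.length = L :=
        ⟨ofList ((ofList z ^ L).toList.take L), ofList ((ofList z ^ L).toList.drop L),
          toList.injective (by simp), by
            have h1 := length_pow (ofList z) L
            have h2 : (ofList ((ofList z ^ L).toList.take L)).length =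
              min L (ofList z ^ L).length := by simp [FreeMonoid.length]
            rw [h2, h1]
            exact min_eq_left (Nat.le_mul_of_pos_right L hzl)⟩
      obtain ⟨P', B', hPB', hP'⟩ : ∃ P B, ofList z' ^ L = P * B ∧ P.length = L :=
        ⟨ofList ((ofList z' ^ L).toList.take L), ofList ((ofList z' ^ L).toList.drop L),
          toList.injective (by simp), by
            have h1 := length_pow (ofList z') L
            have h2 : (ofList ((ofList z' ^ L).toList.take L)).length =
              min L (ofList z' ^ L).length := by simp [FreeMonoid.length]
            rw [h2, h1]
            exact min_eq_left (Nat.le_mul_of_pos_right L (hl ▸ hzl))⟩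
      by_cases hPP : P = P'
      · subst hPP
        obtain ⟨c, x, p, s, hzp, hc, hs, hcx⟩ :=
          exists_parse_of_conj hμ.noncomm.ne_one hw ((mem_rots hμw).1 hzS)
        obtain ⟨d, y, p', s', hzp', hd, hs', hdy⟩ :=
          exists_parse_of_conj hμ.noncomm.ne_one hw ((mem_rots hμw).1 hz'S)
        rcases hL c d x y p s p' s' P hc hd hs hs' hP (hzp ▸ hPB ▸ Dvd.intro _ rfl)
          (hzp' ▸ hPB' ▸ Dvd.intro _ rfl) with rfl | ⟨Q, e, a, X, Y, m, hQ, hae, ha, hb, h1, h2⟩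
        · exfalso
          -- rotations starting at the same depth `p ≠ 1` end with the same letter
          by_cases hp : p = 1
          · subst hp
            refine hzT₁ (Finset.mem_filter.2 ⟨hzT, z', hz'S, hlt, hmin, hlast,
              (of c * x).toList, (mem_rots hw).2 hcx, (of d * y).toList, (mem_rots hw).2 hdy,
              ?_, ?_⟩)
            · apply ofList.injective
              rw [hzp, ofList_toList, ofList_toList, mul_one, map_mul, hc, one_mul]
            · apply ofList.injective
              rw [hzp', ofList_toList, ofList_toList, mul_one, map_mul, hd, one_mul]
          · apply hlast
            have h1 := getLast?_mul (s * μ x) hp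
            have h2 := getLast?_mul (s' * μ y) hp
            rw [← hzp] at h1
            rw [← hzp'] at h2
            exact h1.trans h2.symm
        · have hcw : ∀ b, b ∈ (x * of c).toList ↔ b ∈ (y * of d).toList := fun b => by
            have h3 : Conj (x * of c) (y * of d) :=
              Conj.trans (y := of c * x) ⟨x, of c, rfl, rfl⟩
                (hcx.symm.trans (hdy.trans (z := y * of d) ⟨of d, y, rfl, rfl⟩))
            exact h3.mem_iff b
          rw [← hzp] at h1
          rw [← hzp'] at h2
          obtain ⟨h3, h4⟩ := not_above_and_above hμ.noncomm hl hlt hae ((hcw _).2 hb)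
            ((hcw _).1 ha) h1 h2
          exact ⟨Sum.inr (Q, a), by simp [hI₁ Q hQ], h3, h4⟩
      · -- the prefix of length `L` of the larger rotation separates
        refine ⟨Sum.inl P', by simp [hI₁ P' hP'.le], ?_, ?_⟩
        · have hLne : L ≠ 0 := by
            rintro rfl
            exact hPP ((length_eq_zero.1 hP).trans (length_eq_zero.1 hP').symm)
          obtain ⟨t, c, d, u, v, hcd, hu, hv⟩ := mismatch_of_lt
            (by rw [length_pow, length_pow, hl]) (pow_lt_pow_word hl hlt hLne)
          rw [hPB, mul_assoc] at hu
          rw [hPB', mul_assoc] at hv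
          have htl : t.length < L := by
            by_contra hle
            obtain ⟨q, hq, -⟩ := levi_left hu (by omega)
            obtain ⟨q', hq', -⟩ := levi_left hv (by omega)
            exact hPP (mul_eq_mul_of_length (hq.symm.trans hq') (hP.trans hP'.symm)).1
          refine not_le.2 (lt_of_mismatch hcd (p := t) ?_ ?_)
          · rw [hPB, hu, ← mul_assoc]
            exact Dvd.intro _ rfl
          · rw [← mul_assoc] at hv
            obtain ⟨q, hq, -⟩ := levi_left hv.symm (by rw [length_mul, length_of]; omega)
            rw [hq]
            exact Dvd.intro _ rfl
        · change P'.toList ≤ (ofList z' ^ L).toList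
          rw [hPB', toList_mul]
          exact not_lt.1 fun h => List.IsPrefix.le (List.prefix_append _ _) h

theorem Noncomm.exists_conj_map {α : Type*} {μ : FreeMonoid Bool →* FreeMonoid α}
    (h : Noncomm μ) : ∃ μ' : FreeMonoid Bool →* FreeMonoid α,
      LastDiffer μ' ∧ ∀ x, Conj (μ' x) (μ x) := by
  obtain ⟨μ', σ, h', hσ⟩ := h.exists_conj
  exact ⟨μ', h', fun x => conj_of_semiconj _ le_rfl (hσ x).symm⟩

/-- A primitivity-preserving morphism increases the number of runs by a bounded amount. -/
theorem Noncomm.exists_r_le {Γ : Type*} [Finite Γ] [LinearOrder Γ]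
    {μ : FreeMonoid Bool →* FreeMonoid Γ} (hμ : Noncomm μ) (hpp : PrimitivityPreserving μ) :
    ∃ K, ∀ w, w ≠ 1 → r (μ w) ≤ r w + K := by
  obtain ⟨μ', h', hc⟩ := hμ.exists_conj_map
  obtain ⟨K, hK⟩ := h'.exists_r_le fun w hw => (hc w).symm.isPrimitive (hpp w hw)
  exact ⟨K, fun w hw => (hc w).r_eq ▸ hK w hw⟩

/-! ### Injective morphisms do not decrease the number of runs -/

theorem rots_map {α β : Type*} [LinearOrder α] [LinearOrder β] {μ : FreeMonoid α →* FreeMonoid β}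
    {w : FreeMonoid α} (hw : w ≠ 1) (hμw : μ w ≠ 1) {x : List α} (hx : x ∈ rots w) :
    (μ (ofList x)).toList ∈ rots (μ w) :=
  (mem_rots hμw).2 (((mem_rots hw).1 hx).map μ)

theorem rots_ne_one {α : Type*} [LinearOrder α] {w : FreeMonoid α} (hw : w ≠ 1) {x : List α}
    (hx : x ∈ rots w) : ofList x ≠ 1 := fun h =>
  hw (length_eq_zero.1 (by rw [← rots_length hw hx, h, length_one]))

theorem IsSplit.map_rots_lt {α : Type*} [LinearOrder α] {μ : FreeMonoid Bool →* FreeMonoid α}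
    {τ : FreeMonoid α} {E : Bool → α} (h : IsSplit μ τ E) (hμ : Noncomm μ) {w : FreeMonoid Bool}
    (hw : w ≠ 1) {x y : List Bool} (hx : x ∈ rots w) (hy : y ∈ rots w) (hxy : x < y) :
    (E false < E true → (μ (ofList x)).toList < (μ (ofList y)).toList) ∧
      (E true < E false → (μ (ofList y)).toList < (μ (ofList x)).toList) :=
  h.map_lt_map hμ ((rots_length hw hx).trans (rots_length hw hy).symm)
    ((((mem_rots hw).1 hx).map μ).length_eq.symm.trans (((mem_rots hw).1 hy).map μ).length_eq) hxy

theorem LastDiffer.r_le_r_map {α : Type*} [LinearOrder α] {μ : FreeMonoid Bool →* FreeMonoid α}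
    (hμ : LastDiffer μ) {w : FreeMonoid Bool} (hw : w ≠ 1) : r w ≤ r (μ w) := by
  obtain ⟨τ, E, hE⟩ := hμ.noncomm.exists_isSplit
  have hμw : μ w ≠ 1 := fun h => hw (hμ.injective (by rw [h, map_one]))
  rw [r_eq hw, r_eq hμw]
  refine Nat.add_le_add_left ?_ 1
  have key : ∀ x ∈ transitions List.getLast? (rots w), x ∈ rots w ∧ ∃ y ∈ rots w, x < y ∧
      (∀ z ∈ rots w, x < z → y ≤ z) ∧ x.getLast? ≠ y.getLast? := fun x hx => mem_transitions.1 hx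
  choose! hxS s hs hlt hmin hlast using key
  have hlast' : ∀ x ∈ transitions List.getLast? (rots w),
      (μ (ofList x)).toList.getLast? ≠ (μ (ofList (s x))).toList.getLast? := fun x hx h =>
    hlast x hx ((hμ.getLast?_map_eq (rots_ne_one hw (hxS x hx)) (rots_ne_one hw (hs x hx))).1 h)
  have hd : ∀ x ∈ transitions List.getLast? (rots w), ∀ y ∈ transitions List.getLast? (rots w),
      x ≠ y → s x ≤ y ∨ s y ≤ x := by
    intro x hx y hy hne
    rcases lt_or_gt_of_ne hne with h | h
    · exact Or.inl (hmin x hx y (hxS y hy) h)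
    · exact Or.inr (hmin y hy x (hxS x hx) h)
  rcases lt_or_gt_of_ne hE.1 with hE' | hE'
  · have hmono : ∀ x ∈ rots w, ∀ y ∈ rots w, x ≤ y →
        (μ (ofList x)).toList ≤ (μ (ofList y)).toList := by
      intro x hx y hy h
      rcases h.eq_or_lt with rfl | h
      · exact le_rfl
      · exact ((hE.map_rots_lt hμ.noncomm hw hx hy h).1 hE').le
    refine card_le_card_transitions _ (fun x => (μ (ofList x)).toList)
      (fun x => (μ (ofList (s x))).toList) (fun x hx => rots_map hw hμw (hxS x hx))
      (fun x hx => rots_map hw hμw (hs x hx))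
      (fun x hx => (hE.map_rots_lt hμ.noncomm hw (hxS x hx) (hs x hx) (hlt x hx)).1 hE') hlast' ?_
    intro x hx y hy hne
    exact (hd x hx y hy hne).imp (hmono _ (hs x hx) _ (hxS y hy)) (hmono _ (hs y hy) _ (hxS x hx))
  · have hanti : ∀ x ∈ rots w, ∀ y ∈ rots w, x ≤ y →
        (μ (ofList y)).toList ≤ (μ (ofList x)).toList := by
      intro x hx y hy h
      rcases h.eq_or_lt with rfl | h
      · exact le_rfl
      · exact ((hE.map_rots_lt hμ.noncomm hw hx hy h).2 hE').le
    refine card_le_card_transitions _ (fun x => (μ (ofList (s x))).toList)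
      (fun x => (μ (ofList x)).toList) (fun x hx => rots_map hw hμw (hs x hx))
      (fun x hx => rots_map hw hμw (hxS x hx))
      (fun x hx => (hE.map_rots_lt hμ.noncomm hw (hxS x hx) (hs x hx) (hlt x hx)).2 hE')
      (fun x hx => (hlast' x hx).symm) ?_
    intro x hx y hy hne
    exact (hd x hx y hy hne).symm.imp (hanti _ (hs y hy) _ (hxS x hx))
      (hanti _ (hs x hx) _ (hxS y hy))

/-- A binary morphism whose letter images do not commute does not decrease the number of runs. -/
theorem Noncomm.r_le_r_map {α : Type*} [LinearOrder α] {μ : FreeMonoid Bool →* FreeMonoid α}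
    (hμ : Noncomm μ) {w : FreeMonoid Bool} (hw : w ≠ 1) : r w ≤ r (μ w) := by
  obtain ⟨μ', h', hc⟩ := hμ.exists_conj_map
  exact (hc w).r_eq ▸ h'.r_le_r_map hw

/-! ### Stretching the powers of a letter adds unboundedly many runs -/

/-- The morphism `a ↦ a ^ k`, `b ↦ b`. -/
def stretch (k : ℕ) : FreeMonoid Bool →* FreeMonoid Bool :=
  lift fun c => bif c then of true else of false ^ k

theorem stretch_lastDiffer {k : ℕ} (hk : k ≠ 0) : LastDiffer (stretch k) := by
  refine ⟨id, by simp, fun c => ?_⟩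
  cases c
  · refine ⟨of false ^ (k - 1), ?_⟩
    simp only [stretch, lift_eval_of, cond_false, id]
    rw [← pow_succ, Nat.sub_add_cancel (Nat.pos_of_ne_zero hk)]
  · exact ⟨1, by simp [stretch]⟩

theorem stretch_isSplit {k : ℕ} (hk : k ≠ 0) : IsSplit (stretch k) 1 id := by
  refine ⟨by simp, fun c x _ => ?_⟩
  rw [map_mul, one_mul]
  refine Dvd.dvd.mul_right ?_ _
  cases c
  · exact dvd_pow_self _ hk
  · simp [stretch]

/-- If `m` pairs of adjacent rotations of `w` ending in the same letter are separated, after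
stretching, by a rotation ending in another letter, then the number of runs grows by `m`. -/
theorem r_add_card_le_r_stretch {k : ℕ} (hk : k ≠ 0) {w : FreeMonoid Bool} (hw : w ≠ 1)
    (J : Finset (List Bool))
    (hJ : ∀ x ∈ J, x ∈ rots w ∧ ∃ y ∈ rots w, x < y ∧ (∀ z ∈ rots w, x < z → y ≤ z) ∧
      x.getLast? = y.getLast? ∧ ∃ q ∈ rots (stretch k w),
        (stretch k (ofList x)).toList < q ∧ q < (stretch k (ofList y)).toList ∧
        (stretch k (ofList x)).toList.getLast? ≠ q.getLast?) :
    r w + J.card ≤ r (stretch k w) := by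
  classical
  have hμ := stretch_lastDiffer hk
  have hE := stretch_isSplit hk
  have hμw : stretch k w ≠ 1 := fun h => hw (hμ.injective (by rw [h, map_one]))
  have hdisj : Disjoint (transitions List.getLast? (rots w)) J := by
    rw [Finset.disjoint_left]
    intro x hx hxJ
    obtain ⟨-, y, hy, hxy, hmin, hne⟩ := mem_transitions.1 hx
    obtain ⟨-, y', hy', hxy', hmin', heq, -⟩ := hJ x hxJ
    exact hne (heq.trans (by rw [le_antisymm (hmin y' hy' hxy') (hmin' y hy hxy)]))
  rw [r_eq hw, r_eq hμw, add_assoc, ← Finset.card_union_of_disjoint hdisj]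
  refine Nat.add_le_add_left ?_ 1
  have hlt : ∀ x ∈ rots w, ∀ y ∈ rots w, x < y →
      (stretch k (ofList x)).toList < (stretch k (ofList y)).toList := fun x hx y hy h =>
    (hE.map_rots_lt hμ.noncomm hw hx hy h).1 (by simp)
  have key : ∀ x ∈ transitions List.getLast? (rots w) ∪ J, x ∈ rots w ∧ ∃ y ∈ rots w,
      (∀ z ∈ rots w, x < z → y ≤ z) ∧ ∃ q ∈ rots (stretch k w),
        (stretch k (ofList x)).toList < q ∧ q ≤ (stretch k (ofList y)).toList ∧
        (stretch k (ofList x)).toList.getLast? ≠ q.getLast? := by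
    intro x hx
    rcases Finset.mem_union.1 hx with hx | hx
    · obtain ⟨hxS, y, hy, hxy, hmin, hne⟩ := mem_transitions.1 hx
      exact ⟨hxS, y, hy, hmin, _, rots_map hw hμw hy, hlt x hxS y hy hxy, le_rfl, fun h =>
        hne ((hμ.getLast?_map_eq (rots_ne_one hw hxS) (rots_ne_one hw hy)).1 h)⟩
    · obtain ⟨hxS, y, hy, hxy, hmin, -, q, hq, h1, h2, h3⟩ := hJ x hx
      exact ⟨hxS, y, hy, hmin, q, hq, h1, h2.le, h3⟩
  choose! hxS s hs hmin q hq h1 h2 h3 using key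
  refine card_le_card_transitions _ (fun x => (stretch k (ofList x)).toList) q
    (fun x hx => rots_map hw hμw (hxS x hx)) hq h1 h3 ?_
  have hle : ∀ x ∈ rots w, ∀ y ∈ rots w, x ≤ y →
      (stretch k (ofList x)).toList ≤ (stretch k (ofList y)).toList := by
    intro x hx y hy h
    rcases h.eq_or_lt with rfl | h
    · exact le_rfl
    · exact (hlt x hx y hy h).le
  intro x hx y hy hne
  rcases lt_or_gt_of_ne hne with h | h
  · exact Or.inl ((h2 x hx).trans (hle _ (hs x hx) _ (hxS y hy) (hmin x hx y (hxS y hy) h)))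
  · exact Or.inr ((h2 y hy).trans (hle _ (hs y hy) _ (hxS x hx) (hmin y hy x (hxS x hx) h)))

/-- The exponents that follow the long powers: they are nested, in the sense that from the
`2 i`-th on the `2 i`-th is the largest, and from the `2 i + 1`-st on that one is the smallest. -/
def nestedExp (m j : ℕ) : ℕ := if j % 2 = 0 then 2 * m - j / 2 else (j + 1) / 2

/-- The morphism sending `j` to `a ^ (2 m + 1 + j) b a ^ nestedExp m j b`. -/
def nestedBlock (m : ℕ) : FreeMonoid ℕ →* FreeMonoid Bool :=
  lift fun j => of false ^ (2 * m + 1 + j) * (of true * (of false ^ nestedExp m j * of true))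

/-- The product of the blocks `a ^ (2 m + 1 + j) b a ^ nestedExp m j b` for `j < 2 m`. -/
def nestedWord (m : ℕ) : FreeMonoid Bool := nestedBlock m (ofList (List.range (2 * m)))

theorem suffix_cases {n : ℕ} {p s W : FreeMonoid Bool}
    (h : p * s = of false ^ n * (of true * W)) :
    (∃ i ≤ n, s = of false ^ i * (of true * W)) ∨ ∃ q, W = q * s := by
  rw [← mul_assoc] at h
  rcases levi h with ⟨t, h1, rfl⟩ | ⟨t, -, rfl⟩
  · by_cases ht : t = 1
    · exact Or.inr ⟨1, by rw [ht]; simp⟩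
    · obtain ⟨t, c, rfl⟩ := exists_mul_of ht
      rw [← mul_assoc] at h1
      obtain ⟨h2, rfl⟩ := mul_of_inj h1
      have h3 : t = of false ^ t.length := by
        refine eq_pow_of_notMem fun hmem => ?_
        have h4 := congrArg toList h2
        rw [toList_of_pow, toList_mul] at h4
        have h5 : (!false) ∈ List.replicate n false := h4 ▸ List.mem_append_right _ hmem
        simp at h5
      refine Or.inl ⟨t.length, ?_, by rw [mul_assoc, ← h3]⟩
      have := congrArg FreeMonoid.length h2
      rw [length_pow, length_of, length_mul] at this
      omega
  · exact Or.inr ⟨t, rfl⟩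

theorem nestedBlock_suffix {m j : ℕ} {p s : FreeMonoid Bool} (hs : s ≠ 1)
    (h : nestedBlock m (of j) = p * s) :
    (∃ i ≤ 2 * m + 1 + j,
      s = of false ^ i * (of true * (of false ^ nestedExp m j * of true))) ∨
    ∃ i ≤ nestedExp m j, s = of false ^ i * of true := by
  rcases suffix_cases (h.symm.trans (lift_eval_of _ _)) with h | ⟨q, hq⟩
  · exact Or.inl h
  · have h1 : q * s = of false ^ nestedExp m j * (of true * 1) := by rw [← hq, mul_one]
    rcases suffix_cases h1 with ⟨i, hi, h2⟩ | ⟨q', hq'⟩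
    · exact Or.inr ⟨i, hi, by rw [h2, mul_one]⟩
    · have := congrArg FreeMonoid.length hq'
      rw [length_one, length_mul] at this
      exact absurd (length_eq_zero.1 (by omega)) hs

theorem exists_conj_range {n j : ℕ} (hj : j < n) :
    ∃ R, Conj (ofList (List.range n)) (of j * R) := by
  obtain ⟨A, B, hAB⟩ := List.append_of_mem (List.mem_range.2 hj)
  exact ⟨ofList B * ofList A, ofList A, of j * ofList B, by rw [hAB]; rfl, by rw [mul_assoc]⟩

/-- The rotations of a word with distinct letters are determined by their first letters. -/
theorem eq_of_conj_of_nodup {α : Type*} {j : α} {x R : FreeMonoid α}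
    (h : Conj (of j * x) (of j * R)) (hnd : (of j * x).toList.Nodup) : x = R := by
  obtain ⟨g, k, h1, h2⟩ := h
  by_cases hg : g = 1
  · subst hg
    rw [one_mul] at h1
    rw [mul_one, ← h1] at h2
    exact (of_mul_inj h2).2.symm
  by_cases hk : k = 1
  · subst hk
    rw [mul_one] at h1
    rw [one_mul, ← h1] at h2
    exact (of_mul_inj h2).2.symm
  obtain ⟨c, g, rfl⟩ := exists_of_mul hg
  obtain ⟨d, k, rfl⟩ := exists_of_mul hk
  obtain ⟨rfl, -⟩ := of_mul_inj (h1.trans (mul_assoc _ _ _))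
  obtain ⟨rfl, -⟩ := of_mul_inj (h2.trans (mul_assoc _ _ _))
  rw [h1] at hnd
  simp [List.nodup_append] at hnd

theorem pow_of_dvd {n i : ℕ} (h : n < i) (x : FreeMonoid Bool) :
    of false ^ n * of false ∣ of false ^ i * x := by
  rw [← pow_succ]
  exact (pow_dvd_pow _ h).mul_right _

/-- A rotation starting with a longer power of `a` is smaller. -/
theorem pow_lt_of_lt {n i : ℕ} (h : n < i) (x y : FreeMonoid Bool) :
    (of false ^ i * x).toList < (of false ^ n * (of true * y)).toList :=
  lt_of_mismatch (c := false) (d := true) (by decide) (pow_of_dvd h x)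
    (by rw [← mul_assoc]; exact Dvd.intro _ rfl)

theorem mul_lt_mul_of_lt {α : Type*} [LinearOrder α] (p : FreeMonoid α) {x y : FreeMonoid α}
    (h : x.toList < y.toList) : (p * x).toList < (p * y).toList := by
  induction p using FreeMonoid.inductionOn' with
  | one => simpa using h
  | of_mul c p ih =>
    rw [mul_assoc, mul_assoc, toList_of_mul, toList_of_mul]
    exact List.cons_lt_cons_iff.2 (Or.inr ⟨rfl, ih⟩)

theorem nestedBlock_mul (m j : ℕ) (R : FreeMonoid ℕ) :
    nestedBlock m (of j * R) = of false ^ (2 * m + 1 + j) * (of true *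
      (of false ^ nestedExp m j * (of true * nestedBlock m R))) := by
  rw [map_mul, nestedBlock, lift_eval_of]
  simp only [mul_assoc]

theorem nestedBlock_ne_one (m j : ℕ) : nestedBlock m (of j) ≠ 1 := by
  intro h
  have := congrArg FreeMonoid.length h
  rw [nestedBlock, lift_eval_of] at this
  simp at this

theorem length_le_nestedWord (m : ℕ) : 2 * m ≤ (nestedWord m).length := by
  have : ∀ x : FreeMonoid ℕ, x.length ≤ (nestedBlock m x).length := by
    intro x
    induction x using FreeMonoid.inductionOn' with
    | one => simp
    | of_mul c x ih =>
      have := length_pos_of_ne_one (nestedBlock_ne_one m c)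
      simp only [map_mul, length_mul, length_of]
      omega
  simpa [FreeMonoid.length, nestedWord] using this (ofList (List.range (2 * m)))

theorem nestedExp_le {m j : ℕ} (hj : j < 2 * m) : nestedExp m j ≤ 2 * m := by
  unfold nestedExp; split <;> omega

/-- No rotation of the nested word lies between the rotation starting at the `2 i + 1`-st block and
the rotation starting at the `2 i`-th block. -/
theorem nestedWord_adjacent {m i : ℕ} (hi : i < m) {R R' : FreeMonoid ℕ}
    (hR : Conj (ofList (List.range (2 * m))) (of (2 * i + 1) * R))
    (hR' : Conj (ofList (List.range (2 * m))) (of (2 * i) * R')) {z : FreeMonoid Bool}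
    (hz : Conj (nestedWord m) z) (hlt : (nestedBlock m (of (2 * i + 1) * R)).toList < z.toList) :
    (nestedBlock m (of (2 * i) * R')).toList ≤ z.toList := by
  have hw : ofList (List.range (2 * m)) ≠ 1 := by
    intro h
    have := congrArg FreeMonoid.length h
    simp only [FreeMonoid.length, toList_ofList, List.length_range, toList_one,
      List.length_nil] at this
    omega
  obtain ⟨j, x, p, s, rfl, hj, hs, hjx⟩ := exists_parse_of_conj (nestedBlock_ne_one m) hw hz
  have hjm : j < 2 * m := by
    have := (hjx.mem_iff j).2 (by simp)
    simpa using this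
  have hnd : (of j * x).toList.Nodup :=
    ((conj_iff_isRotated.1 hjx).nodup_iff).1 List.nodup_range
  have e1 : nestedExp m (2 * i + 1) = i + 1 := by unfold nestedExp; split <;> omega
  have e0 : nestedExp m (2 * i) = 2 * m - i := by unfold nestedExp; split <;> omega
  rw [nestedBlock_mul, e1] at hlt
  rw [nestedBlock_mul, e0]
  -- the whole block at the start of the rotation determines the rotation
  have hwhole : s = of false ^ (2 * m + 1 + j) * (of true * (of false ^ nestedExp m j * of true)) →
      s * nestedBlock m x * p = nestedBlock m (of j * x) := by
    intro h
    have hp : p = 1 := by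
      have h1 := congrArg FreeMonoid.length hj
      rw [h, length_mul p, nestedBlock, lift_eval_of] at h1
      exact length_eq_zero.1 (by omega)
    rw [hp, mul_one, map_mul, hj, hp, one_mul]
  rcases nestedBlock_suffix hs hj with ⟨n, hn, hsn⟩ | ⟨n, hn, hsn⟩
  · have hzn : s * nestedBlock m x * p = of false ^ n * (of true *
        (of false ^ nestedExp m j * (of true * (nestedBlock m x * p)))) := by
      rw [hsn]; simp only [mul_assoc]
    rcases lt_trichotomy n (2 * m + 1 + (2 * i)) with h | h | h
    · rw [hzn]
      exact (pow_lt_of_lt h _ _).le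
    · rcases (show 2 * i ≤ j by omega).eq_or_lt with rfl | h'
      · rw [hwhole (by rw [hsn, h]), eq_of_conj_of_nodup (hjx.symm.trans hR') hnd,
          nestedBlock_mul, e0]
      · have hej : nestedExp m j < 2 * m - i := by unfold nestedExp; split <;> omega
        rw [hzn, h]
        refine (mul_lt_mul_of_lt _ (mul_lt_mul_of_lt _ (pow_lt_of_lt hej _ _))).le
    · exfalso
      rcases (show 2 * m + 1 + (2 * i + 1) ≤ n by omega).eq_or_lt with h1 | h1
      · rcases (show 2 * i + 1 ≤ j by omega).eq_or_lt with rfl | h'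
        · rw [hwhole (by rw [hsn, h1]), eq_of_conj_of_nodup (hjx.symm.trans hR) hnd,
            nestedBlock_mul, e1] at hlt
          exact hlt.false
        · have hej : i + 1 < nestedExp m j := by unfold nestedExp; split <;> omega
          rw [hzn, ← h1] at hlt
          exact (mul_lt_mul_of_lt _ (mul_lt_mul_of_lt _ (pow_lt_of_lt hej _ _))).not_gt hlt
      · rw [hzn] at hlt
        exact (pow_lt_of_lt h1 _ _).not_gt hlt
  · have hzn : s * nestedBlock m x * p = of false ^ n * (of true * (nestedBlock m x * p)) := by
      rw [hsn]; simp only [mul_assoc]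
    have := nestedExp_le hjm
    rw [hzn]
    exact (pow_lt_of_lt (by omega) _ _).le

theorem getLast?_nestedBlock (m : ℕ) {x : FreeMonoid ℕ} (hx : x ≠ 1) :
    ∃ y, nestedBlock m x = y * of true := by
  obtain ⟨x, j, rfl⟩ := exists_mul_of hx
  refine ⟨nestedBlock m x * (of false ^ (2 * m + 1 + j) * (of true * of false ^ nestedExp m j)), ?_⟩
  rw [map_mul, nestedBlock, lift_eval_of]
  simp only [mul_assoc]

/-- Stretching the powers of `a` creates at least `m` new runs in the nested word. -/
theorem r_nestedWord_add_le {k : ℕ} (hk : 2 ≤ k) {m : ℕ} (hm : m ≠ 0) :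
    r (nestedWord m) + m ≤ r (stretch k (nestedWord m)) := by
  classical
  have hw : nestedWord m ≠ 1 := by
    intro h
    have := length_le_nestedWord m
    rw [h, length_one] at this
    omega
  have hk0 : k ≠ 0 := by omega
  have hμw : stretch k (nestedWord m) ≠ 1 := fun h =>
    hw ((stretch_lastDiffer hk0).injective (by rw [h, map_one]))
  have hex : ∀ j, ∃ R, j < 2 * m → Conj (ofList (List.range (2 * m))) (of j * R) := by
    intro j
    by_cases hj : j < 2 * m
    · obtain ⟨R, hR⟩ := exists_conj_range hj
      exact ⟨R, fun _ => hR⟩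
    · exact ⟨1, fun h => absurd h hj⟩
  choose R hR using hex
  let X : ℕ → List Bool := fun j => (nestedBlock m (of j * R j)).toList
  have hXmem : ∀ j < 2 * m, X j ∈ rots (nestedWord m) := fun j hj =>
    (mem_rots hw).2 ((hR j hj).map _)
  have hXlt : ∀ i j, i < j → X j < X i := by
    intro i j hij
    simp only [X, nestedBlock_mul]
    exact pow_lt_of_lt (by omega) _ _
  have hinj : Function.Injective fun i => X (2 * i + 1) := by
    intro i j hij
    by_contra hne
    rcases lt_or_gt_of_ne hne with h | h
    · exact (hXlt (2 * i + 1) (2 * j + 1) (by omega)).ne hij.symm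
    · exact (hXlt (2 * j + 1) (2 * i + 1) (by omega)).ne hij
  have hcard : ((Finset.range m).image fun i => X (2 * i + 1)).card = m := by
    rw [Finset.card_image_of_injective _ hinj, Finset.card_range]
  refine (Nat.add_le_add_left hcard.ge _).trans (r_add_card_le_r_stretch hk0 hw _ ?_)
  intro x hx
  obtain ⟨i, hi, rfl⟩ := Finset.mem_image.1 hx
  rw [Finset.mem_range] at hi
  have hlast : ∀ j, ∃ y, nestedBlock m (of j * R j) = y * of true := fun j =>
    getLast?_nestedBlock m (by
      intro h
      have := congrArg FreeMonoid.length h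
      simp at this)
  obtain ⟨y, hy⟩ := hlast (2 * i)
  obtain ⟨y', hy'⟩ := hlast (2 * i + 1)
  refine ⟨hXmem _ (by omega), X (2 * i), hXmem _ (by omega), hXlt _ _ (by omega), ?_, ?_, ?_⟩
  · intro z hz hlt
    exact nestedWord_adjacent hi (hR _ (by omega)) (hR _ (by omega)) (z := ofList z)
      ((mem_rots hw).1 hz) hlt
  · simp only [X, hy, hy', toList_mul, toList_of, List.getLast?_append, List.getLast?_singleton]
    rfl
  · -- drop `k - 1` of the `k` letters `a` that replace the first letter `a`
    have hst : ∀ (n : ℕ) (W : FreeMonoid Bool), stretch k (of false ^ n * (of true * W)) =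
        of false ^ (k * n) * (of true * stretch k W) := by
      intro n W
      rw [map_mul, map_mul, map_pow, stretch, lift_eval_of, lift_eval_of, cond_false, cond_true,
        ← pow_mul]
    obtain ⟨W, hW⟩ : ∃ W, nestedBlock m (of (2 * i + 1) * R (2 * i + 1)) =
      of false ^ (2 * m + 1 + (2 * i + 1)) * (of true * W) := ⟨_, nestedBlock_mul _ _ _⟩
    obtain ⟨W', hW'⟩ : ∃ W, nestedBlock m (of (2 * i) * R (2 * i)) =
      of false ^ (2 * m + 1 + 2 * i) * (of true * W) := ⟨_, nestedBlock_mul _ _ _⟩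
    obtain ⟨t, ht⟩ : ∃ t, t = 2 * m + 1 + 2 * i := ⟨_, rfl⟩
    rw [← ht] at hW'
    rw [show 2 * m + 1 + (2 * i + 1) = t + 1 by omega] at hW
    have hkt : k * (t + 1) = (k - 1) + (k * t + 1) := by
      rw [mul_add]; omega
    refine ⟨(of false ^ (k * t + 1) * (of true * stretch k W) * of false ^ (k - 1)).toList,
      ?_, ?_, ?_, ?_⟩
    · refine (mem_rots hμw).2 ?_
      have h1 := ((hR (2 * i + 1) (by omega)).map (nestedBlock m)).map (stretch k)
      rw [hW, hst, hkt, pow_add, mul_assoc] at h1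
      exact h1.trans ⟨of false ^ (k - 1), _, rfl, rfl⟩
    · simp only [X, ofList_toList, hW, hst, mul_assoc]
      exact pow_lt_of_lt (by rw [hkt]; omega) _ _
    · simp only [X, ofList_toList, hW', hst, mul_assoc]
      exact pow_lt_of_lt (by omega) _ _
    · simp only [X, ofList_toList, hy']
      rw [show of false ^ (k - 1) = of false ^ (k - 2) * of false by
          rw [← pow_succ]; congr 1; omega, map_mul,
        show stretch k (of true) = of true by simp [stretch]]
      simp only [toList_mul, toList_of, List.getLast?_append, List.getLast?_singleton,
        Option.some_or]
      simp

/-! ### Embedding a primitive word in a primitivity-preserving code -/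

/-- The morphism `a ↦ w`, `b ↦ s`. -/
def pairHom {α : Type*} (w s : FreeMonoid α) : FreeMonoid Bool →* FreeMonoid α :=
  lift fun c => bif c then s else w

@[simp]
theorem pairHom_false {α : Type*} (w s : FreeMonoid α) : pairHom w s (of false) = w := by
  simp [pairHom]

@[simp]
theorem pairHom_true {α : Type*} (w s : FreeMonoid α) : pairHom w s (of true) = s := by
  simp [pairHom]

/-- Let `w` contain the letter `b`, and let `s = a ^ N b ^ N` with `N = 2 |w|`. In a product of words
`w` and `s`, every occurrence of `s` is one of the factors of the product. -/
theorem marker_occurs {w s : FreeMonoid Bool} {N : ℕ} (hN : N = 2 * w.length)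
    (hs : s = of false ^ N * of true ^ N) (hw : true ∈ w.toList) {X : FreeMonoid Bool}
    {p q : FreeMonoid Bool} (h : pairHom w s X = p * s * q) :
    ∃ P Q, X = P * of true * Q ∧ pairHom w s P = p := by
  have hwl : 0 < w.length := List.length_pos_of_mem hw
  have hsl : s.toList = List.replicate N false ++ List.replicate N true := by
    rw [hs, toList_mul, toList_of_pow, toList_of_pow]
  have hs0 : ∀ i, i < N → s.toList[i]? = some false := by
    intro i hi
    rw [hsl, List.getElem?_append_left (by simpa using hi)]
    simp [hi]
  have hs1 : ∀ i, N ≤ i → i < 2 * N → s.toList[i]? = some true := by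
    intro i hi hi'
    rw [hsl, List.getElem?_append_right (by simpa using hi), List.getElem?_replicate]
    simp only [List.length_replicate]
    rw [if_pos (by omega)]
  have hsl2 : s.toList.length = 2 * N := by rw [hsl]; simp; omega
  induction X using FreeMonoid.inductionOn' generalizing p with
  | one =>
    have := congrArg (fun x => x.toList.length) h
    simp only [map_one, toList_one, List.length_nil, toList_mul, List.length_append, hsl2] at this
    omega
  | of_mul c X ih =>
    rw [map_mul] at h
    by_cases hl : (pairHom w s (of c)).length ≤ p.length
    · obtain ⟨t, h1, h2⟩ := levi_left (h.trans (mul_assoc _ _ _)) hl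
      rw [← mul_assoc] at h2
      obtain ⟨P, Q, rfl, hP⟩ := ih h2
      exact ⟨of c * P, Q, by simp only [mul_assoc], by rw [map_mul, hP, h1]⟩
    push Not at hl
    -- the letter of the right-hand side at an offset from the beginning of the marker
    have hr : ∀ i, i < 2 * N →
        (pairHom w s (of c) * pairHom w s X).toList[p.toList.length + i]? = s.toList[i]? := by
      intro i hi
      rw [h, toList_mul, toList_mul, List.append_assoc, List.getElem?_append_right (by omega),
        Nat.add_sub_cancel_left, List.getElem?_append_left (by omega)]
    cases c
    · exfalso
      rw [pairHom_false] at hl hr h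
      have hl' : p.toList.length < w.toList.length := hl
      have hN' : N = 2 * w.toList.length := hN
      by_cases hX : X = 1
      · subst hX
        have := congrArg (fun x => x.toList.length) h
        simp only [map_one, mul_one, toList_mul, List.length_append, hsl2] at this
        omega
      obtain ⟨d, X, rfl⟩ := exists_of_mul hX
      cases d
      · obtain ⟨i, hi, hwi⟩ := List.getElem_of_mem hw
        have h1 := hr (w.toList.length - p.toList.length + i) (by omega)
        rw [hs0 _ (by omega), (pairHom w s).map_mul, pairHom_false, toList_mul, toList_mul,
          List.getElem?_append_right (by omega), List.getElem?_append_left (by omega),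
          show p.toList.length + (w.toList.length - p.toList.length + i) - w.toList.length = i by
            omega, List.getElem?_eq_getElem hi, hwi] at h1
        simp at h1
      · have h1 := hr (w.toList.length - p.toList.length + (N - 1)) (by omega)
        rw [hs1 _ (by omega) (by omega), (pairHom w s).map_mul, pairHom_true, toList_mul, toList_mul,
          List.getElem?_append_right (by omega), List.getElem?_append_left (by omega),
          hs0 _ (by omega)] at h1
        simp at h1
    · rw [pairHom_true] at hl hr
      have hl' : p.toList.length < s.toList.length := hl
      have hp : p.toList.length = 0 := by
        by_contra hp
        by_cases hpN : p.toList.length < N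
        · have h1 := hr (N - p.toList.length) (by omega)
          rw [hs0 _ (by omega), toList_mul, List.getElem?_append_left (by omega),
            hs1 _ (by omega) (by omega)] at h1
          simp at h1
        · have h1 := hr 0 (by omega)
          rw [hs0 _ (by omega), toList_mul, List.getElem?_append_left (by omega),
            hs1 _ (by omega) (by omega)] at h1
          simp at h1
      exact ⟨1, X, by simp, by rw [map_one]; exact (length_eq_zero.1 hp).symm⟩

/-- Every primitive word is the image of the letter `a` under a primitivity-preserving morphism. -/
theorem exists_primitivityPreserving {w : FreeMonoid Bool} (hw : IsPrimitive w) :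
    ∃ φ : FreeMonoid Bool →* FreeMonoid Bool, φ (of false) = w ∧ Noncomm φ ∧
      PrimitivityPreserving φ := by
  by_cases hb : true ∈ w.toList
  · obtain ⟨N, hN⟩ : ∃ N, N = 2 * w.length := ⟨_, rfl⟩
    obtain ⟨s, hs⟩ : ∃ s : FreeMonoid Bool, s = of false ^ N * of true ^ N := ⟨_, rfl⟩
    have hnc : Noncomm (pairHom w s) := by
      intro h
      rw [pairHom_false, pairHom_true, hs, mul_assoc] at h
      obtain ⟨t, ht, -⟩ := levi_left h (by rw [length_pow, length_of]; omega)
      have h1 : true ∈ (of false ^ N : FreeMonoid Bool).toList := by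
        rw [ht, toList_mul]
        exact List.mem_append_left _ hb
      simp [toList_of_pow] at h1
    refine ⟨pairHom w s, pairHom_false w s, hnc, fun V hV => ?_⟩
    by_cases hVb : true ∈ V.toList
    · obtain ⟨A, B, hAB⟩ := List.append_of_mem hVb
      have hVc : Conj V (of true * (ofList B * ofList A)) :=
        ⟨ofList A, of true * ofList B, toList.injective hAB, by rw [mul_assoc]⟩
      refine (hVc.map _).symm.isPrimitive ?_
      obtain ⟨W, hW⟩ : ∃ W, W = ofList B * ofList A := ⟨_, rfl⟩
      rw [← hW] at hVc ⊢
      have hVp := hVc.isPrimitive hV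
      have hV1 : pairHom w s (of true * W) ≠ 1 := fun h =>
        hVp.1 (hnc.injective (by rw [h, map_one]))
      refine ⟨hV1, fun y hy k hk => ?_⟩
      rcases Nat.eq_zero_or_pos k with rfl | hk0
      · exact absurd (by simpa using hk) hV1
      -- the marker occurs again after `y`, so `y` is the image of a word
      have h1 : pairHom w s ((of true * W) * (of true * W)) =
          y * s * (pairHom w s W * y ^ (k - 1)) := by
        rw [map_mul, hk, ← pow_add, show k + k = 1 + k + (k - 1) by omega, pow_add, pow_add,
          pow_one, ← hk, map_mul, pairHom_true]
        simp only [mul_assoc]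
      obtain ⟨P, Q, -, hP⟩ := marker_occurs hN hs hb h1
      rw [← hP, ← map_pow] at hk
      refine hVp.2 P ?_ k (hnc.injective hk)
      rintro rfl
      exact hy (by rw [← hP, map_one])
    · rw [hV.eq_of_eq_pow (eq_pow_of_notMem (c := false) hVb), pairHom_false]
      exact hw
  · refine ⟨MonoidHom.id _, (hw.eq_of_eq_pow (eq_pow_of_notMem (c := false) hb)).symm,
      noncomm_of_injective Function.injective_id, fun V hV => hV⟩

/-! ### The characterization -/

theorem addIncrease_le_additiveSensitivity {Γ : Type*} [LinearOrder Γ]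
    (μ : FreeMonoid Bool →* FreeMonoid Γ) (w : FreeMonoid Bool) :
    addIncrease μ w ≤ additiveSensitivity μ w.length := by
  have h := Finset.le_sup' (s := (Finset.univ : Finset (Fin w.length → Bool)))
    (fun v => addIncrease μ (ofList (List.ofFn v)))
    (Finset.mem_univ fun i : Fin w.length => w.toList[i])
  have hw : ofList (List.ofFn fun i : Fin w.length => w.toList[i]) = w :=
    toList.injective List.ofFn_getElem
  simp only [hw] at h
  exact h

theorem not_isCyclicMorphism {Γ : Type*} {μ : FreeMonoid Bool →* FreeMonoid Γ} (hμ : Noncomm μ) :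
    ¬ IsCyclicMorphism μ := by
  rintro ⟨z, -, hz⟩
  obtain ⟨i, hi⟩ := hz false
  obtain ⟨j, hj⟩ := hz true
  exact hμ (by rw [hi, hj, pow_mul_comm])

theorem primitivityPreserving_of_isBWTRunPreserving {Γ : Type*} [LinearOrder Γ]
    {μ : FreeMonoid Bool →* FreeMonoid Γ} (hμ : Function.Injective μ)
    (h : IsBWTRunPreserving μ) : PrimitivityPreserving μ := by
  obtain ⟨K, -, hK⟩ := h
  intro w hw
  by_contra hnp
  have hμw : μ w ≠ 1 := fun h => hw.1 (hμ (by rw [h, map_one]))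
  simp only [IsPrimitive, not_and, not_forall] at hnp
  obtain ⟨u, hu, k, hk, hk1⟩ := hnp hμw
  have hk2 : 2 ≤ k := by
    rcases Nat.eq_zero_or_pos k with rfl | h0
    · exact absurd (by simpa using hk) hμw
    · omega
  obtain ⟨φ, hφw, hφ, hφp⟩ := exists_primitivityPreserving hw
  obtain ⟨C, hC⟩ := hφ.exists_r_le hφp
  -- `μ ∘ φ` factors through the morphism that stretches the powers of `a` by `k`
  let ψ : FreeMonoid Bool →* FreeMonoid Γ := pairHom u (μ (φ (of true)))
  have hfac : ψ.comp (stretch k) = μ.comp φ := by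
    refine hom_eq fun c => ?_
    cases c
    · simp [ψ, stretch, hφw, hk]
    · simp [ψ, stretch]
  have hψ : Noncomm ψ := by
    intro h
    have h1 : Commute u (μ (φ (of true))) := by
      rw [pairHom_false, pairHom_true] at h
      exact h
    have h2 : Commute (u ^ k) (μ (φ (of true))) := h1.pow_left k
    rw [← hk, ← hφw] at h2
    exact hφ (hμ (by simpa using h2.eq))
  obtain ⟨m, hm⟩ : ∃ m, m = C + K + 1 := ⟨_, rfl⟩
  have hlen := length_le_nestedWord m
  have hV1 : nestedWord m ≠ 1 := by
    intro h
    rw [h, length_one] at hlen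
    omega
  have hsV1 : stretch k (nestedWord m) ≠ 1 := fun h =>
    hV1 ((stretch_lastDiffer (k := k) (by omega)).injective (by rw [h, map_one]))
  have h1 := r_nestedWord_add_le hk2 (m := m) (by omega)
  have h2 := hψ.r_le_r_map hsV1
  rw [← MonoidHom.comp_apply, hfac, MonoidHom.comp_apply] at h2
  have h3 := hC (nestedWord m) hV1
  have h4 := (addIncrease_le_additiveSensitivity μ (φ (nestedWord m))).trans
    (hK _ (by
      have := hφ.length_le (nestedWord m)
      rw [Fintype.card_bool]
      omega))
  rw [addIncrease] at h4
  omega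

theorem isBWTRunPreserving_of_primitivityPreserving {Γ : Type*} [Finite Γ] [LinearOrder Γ]
    {μ : FreeMonoid Bool →* FreeMonoid Γ} (hμ : Function.Injective μ)
    (h : PrimitivityPreserving μ) : IsBWTRunPreserving μ := by
  have hμ' := noncomm_of_injective hμ
  obtain ⟨K, hK⟩ := hμ'.exists_r_le h
  refine ⟨K, not_isCyclicMorphism hμ', fun n hn => Finset.sup'_le _ _ fun v _ => ?_⟩
  have := hK (ofList (List.ofFn v)) (by
    intro h
    have := congrArg FreeMonoid.length h
    simp only [FreeMonoid.length, toList_ofList, List.length_ofFn, toList_one,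
      List.length_nil] at this
    rw [Fintype.card_bool] at hn
    omega)
  rw [addIncrease]
  omega

end BWT

/-- The binary alphabet `{a < b}` is `Bool`, with `a = false < true = b`. -/
theorem mainTheorem1 {Γ : Type*} [Finite Γ] [LinearOrder Γ]
    (μ : FreeMonoid Bool →* FreeMonoid Γ) (hμ : Function.Injective μ) :
    BWT.IsBWTRunPreserving μ ↔ BWT.PrimitivityPreserving μ :=
  ⟨BWT.primitivityPreserving_of_isBWTRunPreserving hμ,
    BWT.isBWTRunPreserving_of_primitivityPreserving hμ⟩
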